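/- Let $T>0$ and let $(\Omega,\mathcal F,\mathbb F=(\mathcal F_t)_{t\in[0,T]},\mathbb P)$ be a filtered probability space satisfying the usual conditions. Let $L$ be a real random variable with law $\eta$, let $\mathcal G_t=\bigcap_{t<s\le T}(\mathcal F_s\vee\sigma(L))$ for $t<T$ and $\mathcal G_T=\mathcal F_T\vee\sigma(L)$, and let $\mathbb G=(\mathcal G_t)_{t\in[0,T]}$. For each $t$ let $Q_t(\omega,\mathrm dx)$ be a regular version of the conditional law of $L$ given $\mathcal F_t$. Assume Condition A: for every $t\in[0,T]$ there is a (non-random) $\sigma$-finite measure $\eta_t$ on $\mathbb R$ with $Q_t(\omega,\cdot)\ll\eta_t$ for almost every $\omega$. Let $q_t^x(\omega)\ge 0$ be a corresponding conditional density with respect to $\eta$: for each $t$, $(x,\omega)\mapsto q^x_t(\omega)$ is $\mathcal B(\mathbb R)\otimes\mathcal F_t$-measurable and $Q_t(\omega,\mathrm dx)=q_t^x(\omega)\,\eta(\mathrm dx)$ for almost every $\omega$; and for each $x$ the process $(q^x_t)_{t\in[0,T]}$ is a càdlàg $\mathbb F$-martingale. Let $(M_t)_{t\in[0,T]}$ be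 a continuous local $\mathbb F$-martingale, and let $k=k^x_t(\omega)$ be a real-valued function that is jointly progressively measurable (for each $t$, its restriction to times $s\le t$ is $\mathcal B([0,t])\otimes\mathcal F_t\otimes\mathcal B(\mathbb R)$-measurable in $(s,\omega,x)$; this holds in particular if $k$ is predictable in $(t,\omega)$ jointly with $x$) and such that for every $x\in\mathbb R$, almost surely $\int_0^T|k^x_s|\,q^x_{s-}\,\mathrm d\langle M,M\rangle_s<\infty$ and $$\langle q^x,M\rangle_t=\int_0^t k_s^x\,q_{s-}^x\,\mathrm d\langle M,M\rangle_s\qquad\text{for all }t\in[0,T].$$ Here $\langle q^x,M\rangle$ is the predictable process of finite variation, null at $0$, such that $q^xM-\langle q^x,M\rangle$ is a local $\mathbb F$-martingale, and $\langle M,M\rangle$ is the continuous nondecreasing version of the bracket of $M$ with itself. Then $\int_0^T|k^L_s|\,\mathrm d\langle M,M\rangle_s<\infty$ almost surely, the process $A_t=\int_0^t k_s^L\,\mathrm d\langle M,M\rangle_s$ is $\mathbb G$-adapted with almost surely continuous paths of finite variation, and $$M_t-\int_0^t k_s^L\,\mathrm d\langle M,M\rangle_s,\qquad t\in[0,T],$$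 is a local $\mathbb G$-martingale. Thus $M=(M-A)+A$ is the explicit $\mathbb G$-Doob–Meyer decomposition of $M$. -/

import Mathlib

open MeasureTheory ProbabilityTheory Filter Set Topology
open scoped NNReal ENNReal

noncomputable section

namespace InitialEnlargement

/-- The time interval `[0, T]`. -/
abbrev Time (T : ℝ≥0) : Type := Set.Iic T

variable {T : ℝ≥0} {Ω : Type*} {mΩ : MeasurableSpace Ω}

instance (T : ℝ≥0) : CompactIccSpace (Time T) where
  isCompact_Icc {a b} := by
    rw [Subtype.isCompact_iff]
    have h : (Subtype.val '' Set.Icc a b : Set ℝ≥0) = Set.Icc (a : ℝ≥0) (b : ℝ≥0) := by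
      ext x
      constructor
      · rintro ⟨y, hy, rfl⟩
        exact hy
      · intro hx
        exact ⟨⟨x, hx.2.trans b.2⟩, hx, rfl⟩
    rw [h]
    exact isCompact_Icc

/-- The usual conditions: `F` is right-continuous and `F 0` contains every `P`-null set
(`P s = 0` is outer measure zero, so `P` is in particular complete). -/
structure UsualConditions (F : Filtration (Time T) mΩ) (P : Measure Ω) : Prop where
  rightContinuous : F.IsRightContinuous
  complete : ∀ s : Set Ω, P s = 0 → MeasurableSet[F ⊥] s

/-- The initial enlargement `G t = ⋂_{t < s ≤ T} (F s ∨ σ(L))` for `t < T`,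
and `G T = F T ∨ σ(L)`; see the two lemmas below. -/
def enlargement (F : Filtration (Time T) mΩ) (L : Ω → ℝ) (hL : Measurable L) :
    Filtration (Time T) mΩ :=
  (F ⊔ Filtration.const (Time T) (MeasurableSpace.comap L inferInstance) hL.comap_le).rightCont

lemma enlargement_apply (F : Filtration (Time T) mΩ) (L : Ω → ℝ) (hL : Measurable L)
    (t : Time T) (ht : t < ⊤) :
    enlargement F L hL t = ⨅ s > t, F s ⊔ MeasurableSpace.comap L inferInstance := by
  rw [enlargement, Filtration.rightCont_eq_of_not_isMax _ (not_isMax_iff.2 ⟨⊤, ht⟩)]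
  rfl

lemma enlargement_top (F : Filtration (Time T) mΩ) (L : Ω → ℝ) (hL : Measurable L) :
    enlargement F L hL ⊤ = F ⊤ ⊔ MeasurableSpace.comap L inferInstance := by
  rw [enlargement, Filtration.rightCont_eq_of_isMax _ isMax_top]
  rfl

/-- Right-continuous with left limits. -/
def IsCadlag (f : Time T → ℝ) : Prop :=
  ∀ t, ContinuousWithinAt f (Ici t) t ∧ ∃ l, Tendsto f (𝓝[<] t) (𝓝 l)

/-- Càdlàg local martingale on `[0, T]`: adapted, almost surely càdlàg, and for a localizing
sequence `τ n` of stopping times each `1_{τ n > 0} X^{τ n}` is a martingale.  Stopping times take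
values in `[0, T] ∪ {⊤}` and, `T` being isolated from `⊤`, convergence `τ n → ⊤` means that almost
surely `τ n = ⊤` for all large `n`. -/
structure IsLocalMartingale (F : Filtration (Time T) mΩ) (P : Measure Ω)
    (X : Time T → Ω → ℝ) : Prop where
  adapted : StronglyAdapted F X
  cadlag : ∀ᵐ ω ∂P, IsCadlag (fun t => X t ω)
  locally_martingale : Locally (fun Y => Martingale Y F P) F X P

/-- `A` is (a version of) the predictable bracket `⟨X, Y⟩`: the predictable process of finite
variation, null at `0`, such that `X Y - A` is a local martingale. -/
structure IsBracket (F : Filtration (Time T) mΩ) (P : Measure Ω)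
    (X Y A : Time T → Ω → ℝ) : Prop where
  predictable : IsStronglyPredictable F A
  zero : ∀ᵐ ω ∂P, A ⊥ ω = 0
  cadlag : ∀ᵐ ω ∂P, IsCadlag (fun t => A t ω)
  boundedVariation : ∀ᵐ ω ∂P, BoundedVariationOn (fun t => A t ω) univ
  isLocalMartingale : IsLocalMartingale F P (fun t ω => X t ω * Y t ω - A t ω)

/-- `C` is (a version of) `⟨M, M⟩` for a continuous local martingale `M`: the bracket, with
continuous nondecreasing paths. -/
structure IsQuadraticVariation (F : Filtration (Time T) mΩ) (P : Measure Ω)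
    (M C : Time T → Ω → ℝ) : Prop extends IsBracket F P M M C where
  continuous : ∀ᵐ ω ∂P, Continuous (fun t => C t ω)
  monotone : ∀ᵐ ω ∂P, Monotone (fun t => C t ω)

open scoped Classical in
/-- The Lebesgue-Stieltjes measure `dc` on `[0, T]` of a nondecreasing path `c`
(the zero measure if `c` is not nondecreasing). It does not charge `{0}`. -/
def pathMeasure (c : Time T → ℝ) : Measure (Time T) :=
  if h : Monotone c then h.stieltjesFunction.measure else 0

/-- `κ` is a regular version of the conditional law of `L` given the sub-σ-algebra `m`. -/
structure IsRegularCondLaw (P : Measure Ω) (L : Ω → ℝ) (m : MeasurableSpace Ω)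
    (κ : @Kernel Ω ℝ m inferInstance) : Prop where
  isMarkovKernel : IsMarkovKernel κ
  condExp_eq : ∀ B : Set ℝ, MeasurableSet B →
    (fun ω => (κ ω).real B) =ᵐ[P] P[(L ⁻¹' B).indicator (fun _ => (1 : ℝ)) | m]

/-- Condition A: for all `t`, some (non-random) σ-finite measure dominates `Q_t(ω, ·)`. -/
def ConditionA (P : Measure Ω) (F : Filtration (Time T) mΩ)
    (Q : ∀ t : Time T, @Kernel Ω ℝ (F t) inferInstance) : Prop :=
  ∀ t, ∃ η : Measure ℝ, SigmaFinite η ∧ ∀ᵐ ω ∂P, Q t ω ≪ η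

/-- `q x t ω` is a version of the conditional density `q_t^x(ω)` of `Q_t(ω, dx)` with respect to
the law of `L`: nonnegative, càdlàg in `t`, `B(ℝ) ⊗ F_t`-measurable in `(x, ω)` for each `t`, and
an `F`-martingale for each fixed `x`. -/
structure IsConditionalDensity (P : Measure Ω) (F : Filtration (Time T) mΩ) (L : Ω → ℝ)
    (Q : ∀ t : Time T, @Kernel Ω ℝ (F t) inferInstance) (q : ℝ → Time T → Ω → ℝ) : Prop where
  nonneg : ∀ x t ω, 0 ≤ q x t ω
  cadlag : ∀ x ω, IsCadlag (fun t => q x t ω)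
  measurable : ∀ t, @Measurable (ℝ × Ω) ℝ (@Prod.instMeasurableSpace ℝ Ω inferInstance (F t))
    inferInstance (fun p => q p.1 t p.2)
  density : ∀ t, ∀ᵐ ω ∂P,
    Q t ω = (P.map L).withDensity (fun x => ENNReal.ofReal (q x t ω))
  martingale : ∀ x, Martingale (q x) F P

/-- Joint progressive measurability of a family of processes `k^x`: for each `t`, the map
`((s, ω), x) ↦ k_s^x(ω)` on `([0, t] × Ω) × ℝ` is `(B([0, t]) ⊗ F_t) ⊗ B(ℝ)`-measurable. -/
def IsJointlyProgressive (F : Filtration (Time T) mΩ) (k : ℝ → Time T → Ω → ℝ) : Prop :=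
  ∀ t : Time T,
    @Measurable ((Iic t × Ω) × ℝ) ℝ
      (@Prod.instMeasurableSpace (Iic t × Ω) ℝ
        (@Prod.instMeasurableSpace (Iic t) Ω inferInstance (F t)) inferInstance)
      inferInstance (fun p => k p.2 p.1.1 p.1.2)

/-- The process `∫_0^t k_s^{L} d⟨M, M⟩_s`, where `C = ⟨M, M⟩`. -/
def compensator (k : ℝ → Time T → Ω → ℝ) (L : Ω → ℝ) (C : Time T → Ω → ℝ) :
    Time T → Ω → ℝ :=
  fun t ω => ∫ s in Ioc ⊥ t, k (L ω) s ω ∂(pathMeasure (fun u => C u ω))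

end InitialEnlargement

end

/-! Fix a parameter `x`. The bracket `⟨M, M⟩` is continuous, so its path measure `κ` has no atoms
and `q^x_{s-}` may be replaced by `q^x_s`. The hypothesis then says that `N = q^x M - ∫ k^x q^x dκ`
is a local `F`-martingale. Girsanov's idea turns this into a statement about `M - ∫ k^x dκ`: its
suitably stopped increments, multiplied by `q^x_T` and by an `F_s`-event, have mean zero
(`setIntegral_density_mul_stoppedCompensated`). No integration by parts is needed. Optional sampling
replaces `q^x_T` by `q^x_θ` or `q^x_s` in front of `M_θ` and `M_s`, and the projection identity `E ∫
f_u q_T dκ = E ∫ f_u q_u dκ` replaces it inside the integral. What is left is an increment of `N`.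

The projection identity and optional sampling share one source, `integral_martingale_compProd`.
Under `P ⊗ κ`, the martingale read at the next grid time is the conditional expectation of its
terminal value, so the discretizations are uniformly integrable and converge in `L¹` as the grid is
refined.

Then `x` is replaced by `L`. On `B(ℝ) ⊗ F_T` the law of `ω ↦ (L ω, ω)` has density `q^x_T(ω)` with
respect to `η ⊗ P`, and events of `F_s ∨ σ(L)` are the preimages of `B(ℝ) ⊗ F_s`. Fubini in `x`
therefore gives the martingale property relative to `F_s ∨ σ(L)` (`setIntegral_stoppedFamily_eq`),
and path continuity extends it to `G_s` (`martingale_stoppedFamily`). The localizing times are the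
exit times of `|M|` and `∫ |k^L| dκ` from level `n`. They are built on `ℝ × Ω`, so that the same
object can be read at fixed `x` or at `x = L`.

That `∫ |k^L| dκ` is finite also comes from projection: finiteness of `∫ |k^x| q^x dκ` forces that
of `∫ |k^x| dκ` where `q^x_T > 0`, and the joint law charges nothing else. -/

noncomputable section

namespace InitialEnlargement

variable {T : ℝ≥0} {Ω : Type*} {mΩ : MeasurableSpace Ω}

/-! ### Rounding up to a grid -/

/-- The index of the least multiple of `1 / (j + 1)` above `u`. -/
def gridIndex (j : ℕ) (u : Time T) : ℕ := ⌈(u : ℝ≥0) * (j + 1)⌉₊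

/-- The time `i / (j + 1)`, truncated at `T`. -/
def gridPoint (T : ℝ≥0) (j i : ℕ) : Time T := ⟨min T (i / (j + 1)), mem_Iic.2 (min_le_left _ _)⟩

/-- `u` rounded up to a multiple of `1 / (j + 1)`, truncated at `T`. -/
def gridRound (j : ℕ) (u : Time T) : Time T := gridPoint T j (gridIndex j u)

lemma gridIndex_le (j : ℕ) (u : Time T) : gridIndex j u ≤ ⌈T * (j + 1)⌉₊ :=
  Nat.ceil_mono (mul_le_mul_left u.2 _)

lemma monotone_gridIndex (j : ℕ) : Monotone (gridIndex (T := T) j) := fun _ _ h =>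
  Nat.ceil_mono (mul_le_mul_left (Subtype.coe_le_coe.2 h) _)

lemma measurable_gridIndex (j : ℕ) : Measurable (gridIndex (T := T) j) :=
  (monotone_gridIndex j).measurable

lemma le_gridRound (j : ℕ) (u : Time T) : u ≤ gridRound j u := by
  refine Subtype.coe_le_coe.1 (le_min (mem_Iic.1 u.2) ?_ : (u : ℝ≥0) ≤ min T _)
  rw [le_div_iff₀ (by positivity)]
  exact Nat.le_ceil _

lemma gridRound_le (j : ℕ) (u : Time T) : (gridRound j u : ℝ≥0) ≤ u + 1 / (j + 1) := by
  refine (min_le_right T _).trans ?_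
  rw [div_le_iff₀ (by positivity), add_mul, one_div, inv_mul_cancel₀ (by positivity)]
  exact (Nat.ceil_lt_add_one (by positivity)).le

lemma tendsto_gridRound (u : Time T) :
    Tendsto (fun j => gridRound j u) atTop (𝓝[≥] u) := by
  refine tendsto_nhdsWithin_iff.2 ⟨?_, Eventually.of_forall fun j => le_gridRound j u⟩
  rw [tendsto_subtype_rng]
  refine tendsto_of_tendsto_of_tendsto_of_le_of_le tendsto_const_nhds (?_ : Tendsto
    (fun j : ℕ => (u : ℝ≥0) + 1 / (j + 1)) atTop (𝓝 u)) (fun j => le_gridRound j u)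
    (fun j => gridRound_le j u)
  have := (tendsto_one_div_add_atTop_nhds_zero_nat (𝕜 := ℝ≥0)).const_add (u : ℝ≥0)
  simpa using this

/-! ### Joint measurability of right-continuous families -/

lemma measurable_natIndex_comp {α β γ : Type*} [MeasurableSpace α] [MeasurableSpace β]
    [MeasurableSpace γ] {Y : ℕ → α → γ} (hY : ∀ i, Measurable (Y i)) {n : β → ℕ}
    (hn : Measurable n) : Measurable (fun p : α × β => Y (n p.2) p.1) := by
  have : Measurable fun p : α × ℕ => Y p.2 p.1 := measurable_from_prod_countable_left hY
  exact this.comp (measurable_fst.prodMk (hn.comp measurable_snd))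

lemma measurable_of_rightContinuous {α : Type*} [MeasurableSpace α] {X : Time T → α → ℝ}
    (hX : ∀ u, Measurable (X u)) (hc : ∀ a u, ContinuousWithinAt (fun v => X v a) (Ici u) u) :
    Measurable (fun p : α × Time T => X p.2 p.1) := by
  refine measurable_of_tendsto_metrizable (f := fun j (p : α × Time T) => X (gridRound j p.2) p.1)
    (fun j => measurable_natIndex_comp (Y := fun i => X (gridPoint T j i)) (fun i => hX _)
      (measurable_gridIndex j)) (tendsto_pi_nhds.2 fun p => ?_)
  exact (hc p.1 p.2).tendsto.comp (tendsto_gridRound p.2)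

/-! ### Measures on the time interval -/

lemma measure_Iio_le_of_forall_Iic {ν : Measure (Time T)} {c : ℝ≥0∞} {u : Time T}
    (h : ∀ r < u, ν (Iic r) ≤ c) : ν (Iio u) ≤ c := by
  obtain ⟨D, hD, hDd⟩ := TopologicalSpace.exists_countable_dense (Time T)
  have hU : Iio u = ⋃ r ∈ {r ∈ D | r < u}, Iic r := by
    ext v
    simp only [mem_Iio, mem_iUnion, mem_Iic, exists_prop, mem_ofPred_eq]
    refine ⟨fun hv => ?_, fun ⟨r, hr, hvr⟩ => hvr.trans_lt hr.2⟩
    obtain ⟨r, hr, hr1, hr2⟩ := hDd.exists_between hv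
    exact ⟨r, ⟨hr, hr2⟩, hr1.le⟩
  rw [hU, measure_biUnion_eq_iSup (hD.mono fun _ h => h.1)]
  · exact iSup₂_le fun r hr => h r hr.2
  · intro a ha b hb
    rcases le_total a b with hab | hab
    · exact ⟨b, hb, Iic_subset_Iic.2 hab, Subset.rfl⟩
    · exact ⟨a, ha, Subset.rfl, Iic_subset_Iic.2 hab⟩

/-- The set is an initial segment, hence contained in `Iic s` with `s` in it, or in `Iio s`. It
serves to truncate an integral at level `c` without overshoot, even if the measure has atoms. -/
lemma measure_setOf_Iic_le {ν : Measure (Time T)} (c : ℝ≥0∞) :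
    ν {u | ν (Iic u) ≤ c} ≤ c := by
  set I : Set (Time T) := {u | ν (Iic u) ≤ c} with hI
  rcases I.eq_empty_or_nonempty with h0 | hne
  · simp [h0]
  have hlow : ∀ u ∈ I, ∀ v ≤ u, v ∈ I := fun u hu v hv =>
    (measure_mono (Iic_subset_Iic.2 hv)).trans hu
  let s : Time T := ⟨sSup (Subtype.val '' I), mem_Iic.2 (csSup_le (hne.image _) (by
    rintro _ ⟨u, -, rfl⟩; exact mem_Iic.1 u.2))⟩
  have hbdd : BddAbove (Subtype.val '' I) := ⟨T, by rintro _ ⟨u, -, rfl⟩; exact mem_Iic.1 u.2⟩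
  have hle : ∀ u ∈ I, u ≤ s := fun u hu => le_csSup hbdd ⟨u, hu, rfl⟩
  have hlt : ∀ u < s, u ∈ I := by
    intro u hu
    obtain ⟨_, ⟨v, hv, rfl⟩, huv⟩ := exists_lt_of_lt_csSup (hne.image _)
      (show (u : ℝ≥0) < sSup (Subtype.val '' I) from hu)
    exact hlow v hv u (Subtype.coe_le_coe.1 huv.le)
  by_cases hs : s ∈ I
  · exact (measure_mono hle).trans hs
  · refine (measure_mono fun u hu => ?_).trans
      (measure_Iio_le_of_forall_Iic (u := s) fun r hr => hlt r hr)
    exact (hle u hu).lt_of_ne fun h => hs (h ▸ hu)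

lemma coe_stieltjesFunction_eq_self {R : Type*} [LinearOrder R] [TopologicalSpace R]
    [OrderTopology R] {c : R → ℝ} (hc : Continuous c) (hm : Monotone c) :
    ⇑hm.stieltjesFunction = c := by
  ext u
  rw [hm.stieltjesFunction_eq]
  exact hc.continuousWithinAt.rightLim_eq

lemma pathMeasure_Iic {c : Time T → ℝ} (hc : Continuous c) (hm : Monotone c) (t : Time T) :
    pathMeasure c (Iic t) = ENNReal.ofReal (c t - c ⊥) := by
  have h : Iic t = Icc ⊥ t := Icc_bot.symm
  rw [pathMeasure, dif_pos hm, h, StieltjesFunction.measure_Icc,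
    leftLim_eq_of_isBot isBot_bot, coe_stieltjesFunction_eq_self hc hm]

lemma pathMeasure_singleton {c : Time T → ℝ} (hc : Continuous c) (hm : Monotone c) (t : Time T) :
    pathMeasure c {t} = 0 := by
  have h : Function.leftLim c t = c t := hc.continuousWithinAt.leftLim_eq
  rw [pathMeasure, dif_pos hm, StieltjesFunction.measure_singleton,
    coe_stieltjesFunction_eq_self hc hm, h, sub_self, ENNReal.ofReal_zero]

lemma isFiniteMeasure_pathMeasure {c : Time T → ℝ} (hc : Continuous c) (hm : Monotone c) :
    IsFiniteMeasure (pathMeasure c) :=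
  ⟨by rw [← Iic_top, pathMeasure_Iic hc hm]; exact ENNReal.ofReal_lt_top⟩

/-! ### Jumps of càdlàg paths -/

lemma tendsto_leftLim_of_isCadlag {f : Time T → ℝ} (hf : IsCadlag f) (t : Time T) :
    Tendsto f (𝓝[<] t) (𝓝 (Function.leftLim f t)) :=
  tendsto_leftLim_of_tendsto (hf t).2

/-- Right-continuity at `t` keeps `f`, and so its left limits, close to `f t` just after `t`. Jumps
larger than a fixed size are thus isolated on the right, and a set of such points is countable. -/
lemma countable_leftLim_ne_of_isCadlag {f : Time T → ℝ} (hf : IsCadlag f) :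
    {t | Function.leftLim f t ≠ f t}.Countable := by
  have hU : {t | Function.leftLim f t ≠ f t} ⊆
      ⋃ n : ℕ, {t | 1 / ((n : ℝ) + 1) < |Function.leftLim f t - f t|} := by
    intro t ht
    obtain ⟨n, hn⟩ := exists_nat_one_div_lt (abs_pos.2 (sub_ne_zero.2 ht))
    exact mem_iUnion.2 ⟨n, hn⟩
  refine (countable_iUnion fun n => ?_).mono hU
  set s := {t | 1 / ((n : ℝ) + 1) < |Function.leftLim f t - f t|} with hs
  refine Countable.mono (fun t ht => ?_) (countable_setOfPred_isolated_right_within (s := s))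
  refine ⟨ht, ?_⟩
  set ε : ℝ := 1 / ((n : ℝ) + 1) with hε
  have hεp : 0 < ε := by positivity
  have h1 : ∀ᶠ u in 𝓝[≥] t, |f u - f t| < ε / 2 := by
    have := Metric.tendsto_nhds.1 (hf t).1.tendsto (ε / 2) (by positivity)
    simpa [Real.dist_eq] using this
  have h2 : ∀ᶠ u in 𝓝[>] t, ∀ᶠ v in 𝓝[<] u, |f v - f t| < ε / 2 := by
    have h1' : ∀ᶠ u in 𝓝[>] t, |f u - f t| < ε / 2 :=
      h1.filter_mono (nhdsWithin_mono _ Ioi_subset_Ici_self)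
    have h3 : ∀ᶠ u in 𝓝[>] t, ∀ᶠ v in 𝓝 u, t < v → |f v - f t| < ε / 2 := by
      rw [eventually_nhdsWithin_iff] at h1' ⊢
      filter_upwards [eventually_eventually_nhds.2 h1'] with u hu _ using hu
    filter_upwards [h3, self_mem_nhdsWithin] with u hu htu
    filter_upwards [nhdsWithin_le_nhds hu, nhdsWithin_le_nhds (Ioi_mem_nhds htu)] with v hv htv
      using hv htv
  have h3 : ∀ᶠ u in 𝓝[>] t, u ∉ s := by
    filter_upwards [h2, h1.filter_mono (nhdsWithin_mono _ Ioi_subset_Ici_self),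
      self_mem_nhdsWithin] with u hu hu' htu hus
    have : (𝓝[<] u).NeBot := nhdsLT_neBot_of_exists_lt ⟨t, htu⟩
    have h4 : |Function.leftLim f u - f t| ≤ ε / 2 := by
      have := ((tendsto_leftLim_of_isCadlag hf u).sub_const (f t)).abs
      exact le_of_tendsto this (hu.mono fun _ h => h.le)
    have h5 : |Function.leftLim f u - f u| < ε := by
      have := abs_sub_le (Function.leftLim f u) (f t) (f u)
      rw [abs_sub_comm (f t)] at this
      linarith
    exact absurd hus h5.not_gt
  rw [inter_comm, nhdsWithin_inter']
  exact inf_principal_eq_bot.2 h3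

/-- Allows `q_{s-}` to be traded for `q_s` in integrals against the continuous bracket. -/
lemma leftLim_ae_eq_of_isCadlag {f : Time T → ℝ} (hf : IsCadlag f) {c : Time T → ℝ}
    (hc : Continuous c) (hm : Monotone c) :
    Function.leftLim f =ᵐ[pathMeasure c] f := by
  have : NullSingletonClass (pathMeasure c) := ⟨pathMeasure_singleton hc hm⟩
  exact (countable_leftLim_ne_of_isCadlag hf).measure_zero _

/-! ### Adapted random measures -/

/-- A random measure on `[0, T]` is adapted if the mass of `[0, t]` is `F t`-measurable. -/
def IsAdaptedMeasure (F : Filtration (Time T) mΩ) (κ : Ω → Measure (Time T)) : Prop :=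
  ∀ t, Measurable[F t] fun ω => κ ω (Iic t)

/-- The sets `Iic r` form a generating π-system, and the restricted measure gives them the mass of
`Iic (min r t)`. -/
lemma IsAdaptedMeasure.measurable_restrict {F : Filtration (Time T) mΩ}
    {κ : Ω → Measure (Time T)} (hκ : IsAdaptedMeasure F κ) [∀ ω, IsFiniteMeasure (κ ω)]
    (t : Time T) : Measurable[F t] fun ω => (κ ω).restrict (Iic t) := by
  have hS : ∀ r, Measurable[F t] fun ω => (κ ω).restrict (Iic t) (Iic r) := fun r => by
    have : (fun ω => (κ ω).restrict (Iic t) (Iic r)) = fun ω => κ ω (Iic (min r t)) := by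
      ext ω
      rw [Measure.restrict_apply measurableSet_Iic, Iic_inter_Iic]
    rw [this]
    exact (hκ _).mono (F.mono (min_le_right _ _)) le_rfl
  refine @Measurable.measure_of_isPiSystem Ω (Time T) (F t) _ _ (fun ω => inferInstance) (range Iic)
    ((BorelSpace.measurable_eq (α := Time T)).trans (borel_eq_generateFrom_Iic _)) isPiSystem_Iic
    ?_ ?_
  · rintro _ ⟨r, rfl⟩
    exact hS r
  · rw [← Iic_top]
    exact hS ⊤

lemma IsAdaptedMeasure.measurable_coe {F : Filtration (Time T) mΩ}
    {κ : Ω → Measure (Time T)} (hκ : IsAdaptedMeasure F κ) [∀ ω, IsFiniteMeasure (κ ω)]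
    {t : Time T} {S : Set (Time T)} (hS : MeasurableSet S) (hSt : S ⊆ Iic t) :
    Measurable[F t] fun ω => κ ω S := by
  have := (Measure.measurable_coe hS).comp (hκ.measurable_restrict t)
  convert this using 2 with ω
  rw [Function.comp_apply, Measure.restrict_apply hS, inter_eq_left.2 hSt]

lemma IsAdaptedMeasure.measurable {F : Filtration (Time T) mΩ}
    {κ : Ω → Measure (Time T)} (hκ : IsAdaptedMeasure F κ) [∀ ω, IsFiniteMeasure (κ ω)] :
    Measurable κ := by
  have := (hκ.measurable_restrict ⊤).mono (F.le ⊤) le_rfl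
  simpa using this

/-! ### Martingales integrate against adapted random measures like their terminal value -/

/-- The σ-algebra of sets `⋃ i, A i ×ˢ {u | gridIndex j u = i}` with
`A i ∈ F (gridPoint T j i)`. -/
@[reducible] def gridSigmaAlgebra (F : Filtration (Time T) mΩ) (j : ℕ) :
    MeasurableSpace (Ω × Time T) :=
  MeasurableSpace.comap (fun p : Ω × Time T => (p.1, gridIndex j p.2))
    (⨅ i : ℕ, (F (gridPoint T j i)).map fun ω => (ω, i))

lemma measurableSet_gridSigmaAlgebra_iff {F : Filtration (Time T) mΩ} {j : ℕ}
    {S : Set (Ω × Time T)} : MeasurableSet[gridSigmaAlgebra F j] S ↔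
      ∃ S' : Set (Ω × ℕ), (∀ i, MeasurableSet[F (gridPoint T j i)] {ω | (ω, i) ∈ S'}) ∧
        S = ⋃ i, {ω | (ω, i) ∈ S'} ×ˢ {u | gridIndex j u = i} := by
  rw [gridSigmaAlgebra, MeasurableSpace.measurableSet_comap]
  refine exists_congr fun S' => and_congr ?_ ?_
  · simp only [MeasurableSpace.measurableSet_iInf, MeasurableSpace.map_def]
    rfl
  · rw [eq_comm]
    suffices (fun p : Ω × Time T => (p.1, gridIndex j p.2)) ⁻¹' S' =
      ⋃ i, {ω | (ω, i) ∈ S'} ×ˢ {u | gridIndex j u = i} by rw [this]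
    ext ⟨ω, u⟩
    simp

lemma measurableSet_gridIndex_eq (j i : ℕ) : MeasurableSet {u : Time T | gridIndex j u = i} :=
  measurable_gridIndex j (measurableSet_singleton i)

lemma gridIndex_eq_subset (j i : ℕ) :
    {u : Time T | gridIndex j u = i} ⊆ Iic (gridPoint T j i) := by
  rintro u rfl
  exact le_gridRound j u

lemma gridSigmaAlgebra_le (F : Filtration (Time T) mΩ) (j : ℕ) :
    gridSigmaAlgebra F j ≤ mΩ.prod inferInstance := by
  intro S hS
  obtain ⟨S', hS', rfl⟩ := measurableSet_gridSigmaAlgebra_iff.1 hS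
  exact MeasurableSet.iUnion fun i =>
    ((F.le _) _ (hS' i)).prod (measurableSet_gridIndex_eq j i)

lemma stronglyMeasurable_gridSigmaAlgebra {F : Filtration (Time T) mΩ} {N : Time T → Ω → ℝ}
    (hN : StronglyAdapted F N) (j : ℕ) :
    StronglyMeasurable[gridSigmaAlgebra F j] fun p : Ω × Time T => N (gridRound j p.2) p.1 := by
  refine Measurable.stronglyMeasurable (mα := gridSigmaAlgebra F j) ?_
  intro B hB
  refine measurableSet_gridSigmaAlgebra_iff.2
    ⟨{p | N (gridPoint T j p.2) p.1 ∈ B}, fun i => (hN _).measurable hB, ?_⟩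
  ext ⟨ω, u⟩
  simp [gridRound]

lemma integrable_compProd_fst {P : Measure Ω} [SFinite P] {κ : Kernel Ω (Time T)}
    [IsFiniteKernel κ] {f : Ω → ℝ} (hf : StronglyMeasurable f) (hfi : Integrable f P) :
    Integrable (fun p : Ω × Time T => f p.1) (P ⊗ₘ κ) := by
  have hm : AEStronglyMeasurable (fun p : Ω × Time T => f p.1) (P ⊗ₘ κ) :=
    (hf.comp_measurable measurable_fst).aestronglyMeasurable
  rw [Measure.integrable_compProd_iff hm]
  refine ⟨ae_of_all _ fun ω => integrable_const (f ω), ?_⟩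
  simp only [integral_const, smul_eq_mul]
  refine hfi.norm.bdd_mul (c := κ.bound.toReal) ?_ (ae_of_all _ fun ω => ?_)
  · exact (κ.measurable_coe MeasurableSet.univ).ennreal_toReal.aestronglyMeasurable
  · rw [Real.norm_of_nonneg measureReal_nonneg]
    exact ENNReal.toReal_mono κ.bound_ne_top (κ.measure_le_bound ω _)

section OptionalProjection

variable {F : Filtration (Time T) mΩ} {P : Measure Ω} [IsFiniteMeasure P] {N : Time T → Ω → ℝ}
  {κ : Kernel Ω (Time T)} [IsFiniteKernel κ]

/-- This is why times are rounded up: the grid cell lies before its right endpoint `t`, so its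
`κ`-mass is `F t`-measurable and can be pulled out of the conditional expectation of `N ⊤` given `F
t`. -/
lemma setIntegral_grid (hN : Martingale N F P) (hκ : IsAdaptedMeasure F κ) (j i : ℕ) {A : Set Ω}
    (hA : MeasurableSet[F (gridPoint T j i)] A) :
    ∫ p in A ×ˢ {u | gridIndex j u = i}, N (gridRound j p.2) p.1 ∂(P ⊗ₘ κ) =
      ∫ p in A ×ˢ {u | gridIndex j u = i}, N ⊤ p.1 ∂(P ⊗ₘ κ) := by
  set t := gridPoint T j i with ht
  have hAm := F.le _ _ hA
  have hE := measurableSet_gridIndex_eq (T := T) j i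
  have h1 : ∫ p in A ×ˢ {u | gridIndex j u = i}, N (gridRound j p.2) p.1 ∂(P ⊗ₘ κ) =
      ∫ p in A ×ˢ {u | gridIndex j u = i}, N t p.1 ∂(P ⊗ₘ κ) := by
    refine setIntegral_congr_fun (hAm.prod hE) fun p hp => ?_
    have : gridIndex j p.2 = i := hp.2
    simp only [gridRound, this, ht]
  have hint : ∀ u, Integrable (fun p : Ω × Time T => N u p.1) (P ⊗ₘ κ) := fun u =>
    integrable_compProd_fst ((hN.1 u).mono (F.le u)) (hN.integrable u)
  rw [h1, Measure.setIntegral_compProd hAm hE (hint _).integrableOn,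
    Measure.setIntegral_compProd hAm hE (hint _).integrableOn]
  simp only [setIntegral_const, smul_eq_mul]
  set g : Ω → ℝ := fun ω => (κ ω).real {u | gridIndex j u = i} with hg
  have hgm : StronglyMeasurable[F t] g :=
    (hκ.measurable_coe hE (gridIndex_eq_subset j i)).ennreal_toReal.stronglyMeasurable
  have hgN : ∀ u, Integrable (g * N u) P := fun u => by
    refine (hN.integrable u).bdd_mul (c := κ.bound.toReal)
      (hgm.mono (F.le t)).aestronglyMeasurable (ae_of_all _ fun ω => ?_)
    rw [Real.norm_of_nonneg measureReal_nonneg]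
    exact ENNReal.toReal_mono κ.bound_ne_top (κ.measure_le_bound ω _)
  have h2 : P[g * N ⊤ | F t] =ᵐ[P] g * N t :=
    (condExp_mul_of_stronglyMeasurable_left hgm (hgN ⊤) (hN.integrable ⊤)).trans
      ((ae_eq_refl g).mul (hN.2 t ⊤ le_top))
  calc ∫ ω in A, g ω * N t ω ∂P = ∫ ω in A, (P[g * N ⊤ | F t]) ω ∂P :=
        (setIntegral_congr_ae hAm (h2.mono fun ω h _ => h)).symm
    _ = ∫ ω in A, g ω * N ⊤ ω ∂P := setIntegral_condExp (F.le t) (hgN ⊤) hA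

lemma integrable_gridRound (hN : Martingale N F P) (j : ℕ) :
    Integrable (fun p : Ω × Time T => N (gridRound j p.2) p.1) (P ⊗ₘ κ) := by
  have hU : (univ : Set (Ω × Time T)) =
      ⋃ i ∈ Finset.range (⌈T * (j + 1)⌉₊ + 1), (univ ×ˢ {u | gridIndex j u = i}) := by
    refine (eq_univ_of_forall fun p => ?_).symm
    simpa using Nat.lt_succ_of_le (gridIndex_le j p.2)
  rw [← integrableOn_univ, hU, integrableOn_finset_iUnion]
  intro i _
  have h := (integrable_compProd_fst (κ := κ) ((hN.1 (gridPoint T j i)).mono (F.le _))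
    (hN.integrable (gridPoint T j i))).integrableOn (s := univ ×ˢ {u | gridIndex j u = i})
  refine h.congr_fun (fun p hp => ?_) (MeasurableSet.univ.prod (measurableSet_gridIndex_eq j i))
  have : gridIndex j p.2 = i := hp.2
  simp only [gridRound, this]

lemma gridRound_ae_eq_condExp (hN : Martingale N F P) (hκ : IsAdaptedMeasure F κ) (j : ℕ) :
    (fun p : Ω × Time T => N (gridRound j p.2) p.1) =ᵐ[P ⊗ₘ κ]
      (P ⊗ₘ κ)[fun p => N ⊤ p.1 | gridSigmaAlgebra F j] := by
  have hgi := integrable_gridRound (κ := κ) hN j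
  have hTi : Integrable (fun p : Ω × Time T => N ⊤ p.1) (P ⊗ₘ κ) :=
    integrable_compProd_fst ((hN.1 ⊤).mono (F.le ⊤)) (hN.integrable ⊤)
  refine ae_eq_condExp_of_forall_setIntegral_eq (gridSigmaAlgebra_le F j) hTi
    (fun S _ _ => hgi.integrableOn) (fun S hS _ => ?_)
    (stronglyMeasurable_gridSigmaAlgebra hN.1 j).aestronglyMeasurable
  obtain ⟨S', hS', rfl⟩ := measurableSet_gridSigmaAlgebra_iff.1 hS
  have hm : ∀ i, MeasurableSet ({ω | (ω, i) ∈ S'} ×ˢ {u : Time T | gridIndex j u = i}) := fun i =>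
    ((F.le _) _ (hS' i)).prod (measurableSet_gridIndex_eq j i)
  have hd : Pairwise (Function.onFun Disjoint
      fun i => {ω | (ω, i) ∈ S'} ×ˢ {u : Time T | gridIndex j u = i}) := by
    intro a b hab
    refine disjoint_left.2 fun p hp hp' => hab ?_
    have h1 : gridIndex j p.2 = a := hp.2
    have h2 : gridIndex j p.2 = b := hp'.2
    exact h1.symm.trans h2
  rw [integral_iUnion hm hd hgi.integrableOn, integral_iUnion hm hd hTi.integrableOn]
  exact tsum_congr fun i => setIntegral_grid hN hκ j i (hS' i)

/-- A right-continuous martingale integrates against a bounded adapted random measure like its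
terminal value. -/
theorem integral_martingale_compProd (hN : Martingale N F P)
    (hc : ∀ ω u, ContinuousWithinAt (fun v => N v ω) (Ici u) u) (hκ : IsAdaptedMeasure F κ) :
    Integrable (fun p : Ω × Time T => N p.2 p.1) (P ⊗ₘ κ) ∧
      ∫ p, N p.2 p.1 ∂(P ⊗ₘ κ) = ∫ p, N ⊤ p.1 ∂(P ⊗ₘ κ) := by
  have hTi : Integrable (fun p : Ω × Time T => N ⊤ p.1) (P ⊗ₘ κ) :=
    integrable_compProd_fst ((hN.1 ⊤).mono (F.le ⊤)) (hN.integrable ⊤)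
  -- Conditional expectations of a single integrable function are uniformly integrable. This
  -- upgrades the pointwise limit given by right-continuity to an `L¹` limit.
  have hUI : UniformIntegrable (fun j (p : Ω × Time T) => N (gridRound j p.2) p.1) 1 (P ⊗ₘ κ) :=
    (hTi.uniformIntegrable_condExp (gridSigmaAlgebra_le F)).ae_eq
      fun j => (gridRound_ae_eq_condExp hN hκ j).symm
  have hlim : ∀ᵐ p ∂(P ⊗ₘ κ), Tendsto (fun j => N (gridRound j p.2) p.1) atTop (𝓝 (N p.2 p.1)) :=
    ae_of_all _ fun p => (hc p.1 p.2).tendsto.comp (tendsto_gridRound p.2)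
  have hmem : MemLp (fun p : Ω × Time T => N p.2 p.1) 1 (P ⊗ₘ κ) :=
    hUI.memLp_of_ae_tendsto hlim
  have hL1 := tendsto_Lp_finite_of_tendsto_ae le_rfl ENNReal.one_ne_top
    (fun j => (integrable_gridRound hN j).aestronglyMeasurable) hmem hUI.unifIntegrable hlim
  refine ⟨memLp_one_iff_integrable.1 hmem, ?_⟩
  have h1 := tendsto_integral_of_L1' _ hmem.aestronglyMeasurable
    (Eventually.of_forall fun j => integrable_gridRound hN j) hL1
  refine tendsto_nhds_unique h1 (tendsto_const_nhds.congr fun j => ?_)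
  rw [integral_congr_ae (gridRound_ae_eq_condExp hN hκ j), integral_condExp (gridSigmaAlgebra_le F j)]

end OptionalProjection

/-! ### Integrals against measurable families of finite measures -/

/-- Bracket measures have finite but not uniformly bounded mass. Splitting the base by the integer
part `n` of the mass gives pieces bounded by `n + 1`. -/
lemma isSFiniteKernel_of_isFiniteMeasure {α β : Type*} {mα : MeasurableSpace α}
    {mβ : MeasurableSpace β} (κ : Kernel α β) [h : ∀ a, IsFiniteMeasure (κ a)] :
    IsSFiniteKernel κ := by
  classical
  have hm : Measurable fun a => ⌊(κ a univ).toNNReal⌋₊ :=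
    Nat.measurable_floor.comp (κ.measurable_coe MeasurableSet.univ).ennreal_toNNReal
  have hA : ∀ n : ℕ, MeasurableSet {a | ⌊(κ a univ).toNNReal⌋₊ = n} := fun n =>
    hm (measurableSet_singleton n)
  refine ⟨fun n => Kernel.piecewise (hA n) κ 0, fun n => ⟨⟨n + 1, by finiteness, fun a => ?_⟩⟩, ?_⟩
  · rw [Kernel.piecewise_apply]
    split_ifs with ha
    · have h1 : ⌊(κ a univ).toNNReal⌋₊ = n := ha
      have h2 := (Nat.lt_floor_add_one (κ a univ).toNNReal).le
      rw [h1] at h2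
      rw [← ENNReal.coe_toNNReal (measure_ne_top (κ a) univ)]
      exact_mod_cast h2
    · simp
  · ext a s hs
    rw [Kernel.sum_apply' _ _ hs, tsum_eq_single ⌊(κ a univ).toNNReal⌋₊]
    · rw [Kernel.piecewise_apply', if_pos]
      rfl
    · intro n hn
      rw [Kernel.piecewise_apply', if_neg]
      · simp
      · exact fun h => hn h.symm

lemma measurable_lintegral_family {α β : Type*} [MeasurableSpace α] [MeasurableSpace β]
    {ν : α → Measure β} (hν : Measurable ν) [∀ a, IsFiniteMeasure (ν a)]
    {f : α × β → ℝ≥0∞} (hf : Measurable f) : Measurable fun a => ∫⁻ u, f (a, u) ∂ν a := by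
  let κ : Kernel α β := ⟨ν, hν⟩
  have : ∀ a, IsFiniteMeasure (κ a) := fun a => inferInstanceAs (IsFiniteMeasure (ν a))
  have := isSFiniteKernel_of_isFiniteMeasure κ
  exact hf.lintegral_kernel_prod_right' (κ := κ)

lemma measurable_integral_family {α β : Type*} [MeasurableSpace α] [MeasurableSpace β]
    {ν : α → Measure β} (hν : Measurable ν) [∀ a, IsFiniteMeasure (ν a)]
    {f : α × β → ℝ} (hf : Measurable f) : Measurable fun a => ∫ u, f (a, u) ∂ν a := by
  let κ : Kernel α β := ⟨ν, hν⟩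
  have : ∀ a, IsFiniteMeasure (κ a) := fun a => inferInstanceAs (IsFiniteMeasure (ν a))
  have := isSFiniteKernel_of_isFiniteMeasure κ
  exact (hf.stronglyMeasurable.integral_kernel_prod_right' (κ := κ)).measurable

/-! ### Progressive measurability -/

lemma measurableSpace_prod_mono {α β : Type*} {m₁ m₂ : MeasurableSpace α}
    {n₁ n₂ : MeasurableSpace β} (hm : m₁ ≤ m₂) (hn : n₁ ≤ n₂) : m₁.prod n₁ ≤ m₂.prod n₂ :=
  sup_le_sup (MeasurableSpace.comap_mono hm) (MeasurableSpace.comap_mono hn)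

/-- `f` is progressive if each `(ω, u) ↦ f (ω, u ∧ t)` is `F t ⊗ B([0, T])`-measurable. -/
def IsProgressive {β : Type*} [MeasurableSpace β] (F : Filtration (Time T) mΩ)
    (f : Ω × Time T → β) : Prop :=
  ∀ t, Measurable[(F t).prod inferInstance] fun p : Ω × Time T => f (p.1, min p.2 t)

namespace IsProgressive

variable {F : Filtration (Time T) mΩ} {β γ : Type*} [MeasurableSpace β] [MeasurableSpace γ]

lemma measurable {f : Ω × Time T → β} (hf : IsProgressive F f) : Measurable f := by
  have h := (hf ⊤).mono (measurableSpace_prod_mono (F.le ⊤) le_rfl) le_rfl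
  simpa using h

lemma measurable_apply {f : Ω × Time T → β} (hf : IsProgressive F f) (t : Time T) :
    Measurable[F t] fun ω => f (ω, t) := by
  have h := (hf t).comp (Measurable.prodMk (m := F t) (@measurable_id _ (F t))
    (@measurable_const _ _ _ (F t) t))
  simpa [Function.comp_def] using h

lemma comp {g : β → γ} (hg : Measurable g) {f : Ω × Time T → β} (hf : IsProgressive F f) :
    IsProgressive F fun p => g (f p) := fun t => hg.comp (hf t)

lemma prodMk {f : Ω × Time T → β} {g : Ω × Time T → γ} (hf : IsProgressive F f)
    (hg : IsProgressive F g) : IsProgressive F fun p => (f p, g p) := fun t =>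
  Measurable.prodMk (hf t) (hg t)

lemma of_le {F' : Filtration (Time T) mΩ} (h : F ≤ F') {f : Ω × Time T → β}
    (hf : IsProgressive F f) : IsProgressive F' f := fun t =>
  (hf t).mono (measurableSpace_prod_mono (h t) le_rfl) le_rfl

end IsProgressive

lemma isProgressive_of_rightContinuous {F : Filtration (Time T) mΩ} {X : Time T → Ω → ℝ}
    (hX : StronglyAdapted F X) (hc : ∀ ω u, ContinuousWithinAt (fun v => X v ω) (Ici u) u) :
    IsProgressive F fun p => X p.2 p.1 := by
  intro t
  refine @measurable_of_rightContinuous T Ω (F t) (fun u ω => X (min u t) ω)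
    (fun u => (hX _).measurable.mono (F.mono (min_le_right _ _)) le_rfl) fun ω u => ?_
  have h1 : ContinuousWithinAt (fun v : Time T => min v t) (Ici u) u :=
    (continuous_id.min continuous_const).continuousWithinAt
  exact ContinuousWithinAt.comp (g := fun v => X v ω) (t := Ici (min u t)) (hc ω _) h1
    fun v hv => min_le_min_right t hv

section Integrals

variable {F : Filtration (Time T) mΩ} {κ : Ω → Measure (Time T)} [∀ ω, IsFiniteMeasure (κ ω)]

lemma IsAdaptedMeasure.measurable_restrict_fst (hκ : IsAdaptedMeasure F κ) (t : Time T) :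
    Measurable[(F t).prod inferInstance]
      fun p : Ω × Time T => (κ p.1).restrict (Iic t) :=
  (hκ.measurable_restrict t).comp (@measurable_fst _ _ (F t) _)

lemma measurable_indicator_le {α β : Type*} [MeasurableSpace α] [MeasurableSpace β] [Zero β]
    {f : α × Time T → β} {τ : α → Time T} (hf : Measurable f) (hτ : Measurable τ) :
    Measurable fun p : α × Time T => (Iic (τ p.1)).indicator (fun s => f (p.1, s)) p.2 := by
  have hS : MeasurableSet {p : α × Time T | p.2 ≤ τ p.1} :=
    measurableSet_le measurable_snd (hτ.comp measurable_fst)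
  convert hf.indicator hS using 2 with p
  by_cases h : p.2 ≤ τ p.1 <;> simp [h, indicator]

/-- An integral over `Iic (min u t)` becomes that of this function against `κ` restricted to `Iic
t`; both ingredients are known at time `t`. -/
lemma IsProgressive.shift {β : Type*} [MeasurableSpace β] [Zero β] {f : Ω × Time T → β}
    (hf : IsProgressive F f) (t : Time T) :
    Measurable[((F t).prod inferInstance).prod inferInstance]
      fun p : (Ω × Time T) × Time T =>
        (Iic (min p.1.2 t)).indicator (fun s => f (p.1.1, min s t)) p.2 := by
  have h1 : @Measurable _ _ (((F t).prod inferInstance).prod inferInstance)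
      ((F t).prod inferInstance) fun p : (Ω × Time T) × Time T => (p.1.1, p.2) :=
    Measurable.prodMk
      ((@measurable_fst _ _ (F t) _).comp (@measurable_fst _ _ ((F t).prod inferInstance) _))
      (@measurable_snd _ _ ((F t).prod inferInstance) _)
  exact @measurable_indicator_le T (Ω × Time T) β ((F t).prod inferInstance) _ _
    (fun p => f (p.1.1, min p.2 t)) (fun p => min p.2 t) ((hf t).comp h1)
    ((measurable_id.min measurable_const).comp (@measurable_snd _ _ (F t) _))

lemma setLIntegral_Iic_eq_indicator (μ : Measure (Time T)) (f : Time T → ℝ≥0∞) {u t : Time T}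
    (hut : u ≤ t) : ∫⁻ s in Iic u, f s ∂μ =
      ∫⁻ s, (Iic u).indicator (fun s => f (min s t)) s ∂μ.restrict (Iic t) := by
  rw [lintegral_indicator measurableSet_Iic, Measure.restrict_restrict measurableSet_Iic,
    inter_eq_left.2 (Iic_subset_Iic.2 hut)]
  refine setLIntegral_congr_fun measurableSet_Iic fun s hs => ?_
  simp only [min_eq_left (le_trans (mem_Iic.1 hs) hut)]

lemma setIntegral_Iic_eq_indicator (μ : Measure (Time T)) (f : Time T → ℝ) {u t : Time T}
    (hut : u ≤ t) : ∫ s in Iic u, f s ∂μ =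
      ∫ s, (Iic u).indicator (fun s => f (min s t)) s ∂μ.restrict (Iic t) := by
  rw [integral_indicator measurableSet_Iic, Measure.restrict_restrict measurableSet_Iic,
    inter_eq_left.2 (Iic_subset_Iic.2 hut)]
  refine setIntegral_congr_fun measurableSet_Iic fun s hs => ?_
  simp only [min_eq_left (le_trans (mem_Iic.1 hs) hut)]

lemma IsProgressive.setLIntegral_Iic {f : Ω × Time T → ℝ≥0∞} (hf : IsProgressive F f)
    (hκ : IsAdaptedMeasure F κ) :
    IsProgressive F fun p => ∫⁻ s in Iic p.2, f (p.1, s) ∂κ p.1 := by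
  intro t
  have h := @measurable_lintegral_family (Ω × Time T) (Time T) ((F t).prod inferInstance) _ _
    (hκ.measurable_restrict_fst t) (fun p => inferInstance) _ (hf.shift t)
  convert h using 2 with p
  exact setLIntegral_Iic_eq_indicator _ (fun s => f (p.1, s)) (min_le_right _ _)

lemma IsProgressive.setIntegral_Iic {f : Ω × Time T → ℝ} (hf : IsProgressive F f)
    (hκ : IsAdaptedMeasure F κ) :
    IsProgressive F fun p => ∫ s in Iic p.2, f (p.1, s) ∂κ p.1 := by
  intro t
  have h := @measurable_integral_family (Ω × Time T) (Time T) ((F t).prod inferInstance) _ _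
    (hκ.measurable_restrict_fst t) (fun p => inferInstance) _ (hf.shift t)
  convert h using 2 with p
  exact setIntegral_Iic_eq_indicator _ (fun s => f (p.1, s)) (min_le_right _ _)

lemma IsProgressive.isAdaptedMeasure_withDensity {f : Ω × Time T → ℝ≥0∞} (hf : IsProgressive F f)
    (hκ : IsAdaptedMeasure F κ) :
    IsAdaptedMeasure F fun ω => (κ ω).withDensity fun u => f (ω, u) := by
  intro t
  have := (hf.setLIntegral_Iic hκ).measurable_apply t
  simpa only [withDensity_apply _ measurableSet_Iic] using this

lemma IsAdaptedMeasure.isProgressive_Iic (hκ : IsAdaptedMeasure F κ) :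
    IsProgressive F fun p : Ω × Time T => κ p.1 (Iic p.2) := by
  have h1 : IsProgressive F fun _ : Ω × Time T => (1 : ℝ≥0∞) := fun t =>
    @measurable_const _ _ _ ((F t).prod inferInstance) _
  simpa using h1.setLIntegral_Iic hκ

end Integrals

/-! ### Optional sampling -/

section Sampling

variable {F : Filtration (Time T) mΩ} {P : Measure Ω} [IsFiniteMeasure P] {N : Time T → Ω → ℝ}

/-- Apply `integral_martingale_compProd` to the random measure `W δ_θ`. Its adaptedness is exactly
the measurability asked of `W` on `{θ ≤ r}`. -/
lemma integral_mul_sampling_of_nonneg (hN : Martingale N F P)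
    (hc : ∀ ω u, ContinuousWithinAt (fun v => N v ω) (Ici u) u) {θ : Ω → Time T} {W : Ω → ℝ}
    {c : ℝ} (h0 : ∀ ω, 0 ≤ W ω) (hWc : ∀ ω, W ω ≤ c)
    (hW : ∀ r, Measurable[F r] ({ω | θ ω ≤ r}.indicator W)) :
    Integrable (fun ω => W ω * N (θ ω) ω) P ∧
      ∫ ω, W ω * N (θ ω) ω ∂P = ∫ ω, W ω * N ⊤ ω ∂P := by
  let ν : Ω → Measure (Time T) := fun ω => ENNReal.ofReal (W ω) • Measure.dirac (θ ω)
  have hfin : ∀ ω, IsFiniteMeasure (ν ω) := fun ω =>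
    ⟨by simp [ν]⟩
  have had : IsAdaptedMeasure F ν := by
    intro t
    have : (fun ω => ν ω (Iic t)) = fun ω => ENNReal.ofReal ({ω | θ ω ≤ t}.indicator W ω) := by
      ext ω
      by_cases h : θ ω ≤ t <;> simp [ν, h, indicator]
    rw [this]
    exact ENNReal.measurable_ofReal.comp (hW t)
  let κ : Kernel Ω (Time T) := ⟨ν, had.measurable⟩
  have : IsFiniteKernel κ := ⟨⟨ENNReal.ofReal c, ENNReal.ofReal_lt_top, fun ω => by
    change ν ω univ ≤ _
    simpa [ν] using ENNReal.ofReal_le_ofReal (hWc ω)⟩⟩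
  obtain ⟨h1, h2⟩ := integral_martingale_compProd (κ := κ) hN hc had
  have h3 : ∀ f : Time T → ℝ, ∀ ω, ∫ u, f u ∂κ ω = W ω * f (θ ω) := by
    intro f ω
    change ∫ u, f u ∂(ENNReal.ofReal (W ω) • Measure.dirac (θ ω)) = _
    rw [integral_smul_measure, integral_dirac, ENNReal.toReal_ofReal (h0 ω), smul_eq_mul]
  refine ⟨?_, ?_⟩
  · simpa only [h3, Kernel.prodMkLeft_apply, Kernel.const_apply] using h1.integral_compProd
  · rw [Measure.integral_compProd h1, Measure.integral_compProd
      (integrable_compProd_fst ((hN.1 ⊤).mono (F.le ⊤)) (hN.integrable ⊤))] at h2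
    simpa only [h3] using h2

/-- Optional sampling: `E[W N_θ] = E[W N_T]` for bounded `F_θ`-measurable `W`. -/
lemma integral_mul_sampling (hN : Martingale N F P)
    (hc : ∀ ω u, ContinuousWithinAt (fun v => N v ω) (Ici u) u) {θ : Ω → Time T} {W : Ω → ℝ}
    {c : ℝ} (hWc : ∀ ω, |W ω| ≤ c) (hW : ∀ r, Measurable[F r] ({ω | θ ω ≤ r}.indicator W)) :
    Integrable (fun ω => W ω * N (θ ω) ω) P ∧
      ∫ ω, W ω * N (θ ω) ω ∂P = ∫ ω, W ω * N ⊤ ω ∂P := by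
  have hWm : Measurable W := by
    have := (hW ⊤).mono (F.le ⊤) le_rfl
    simpa using this
  have aux : ∀ V : Ω → ℝ, (∀ r, Measurable[F r] ({ω | θ ω ≤ r}.indicator V)) → ∀ r,
      Measurable[F r] ({ω | θ ω ≤ r}.indicator fun ω => max (V ω) 0) := by
    intro V hV r
    have h : ({ω | θ ω ≤ r}.indicator fun ω => max (V ω) 0) =
        fun ω => max ({ω | θ ω ≤ r}.indicator V ω) 0 := by
      ext ω
      by_cases h : θ ω ≤ r <;> simp [h, indicator]
    rw [h]
    exact (measurable_id.max measurable_const : Measurable fun x : ℝ => max x 0).comp (hV r)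
  have hWn : ∀ r, Measurable[F r] ({ω | θ ω ≤ r}.indicator fun ω => -W ω) := fun r => by
    have h : ({ω | θ ω ≤ r}.indicator fun ω => -W ω) =
        fun ω => -({ω | θ ω ≤ r}.indicator W ω) := indicator_neg _ _
    rw [h]
    exact measurable_neg.comp (hW r)
  obtain ⟨i1, e1⟩ := integral_mul_sampling_of_nonneg hN hc (W := fun ω => max (W ω) 0)
    (fun _ => le_max_right _ _) (fun ω => max_le ((le_abs_self _).trans (hWc ω))
      ((abs_nonneg _).trans (hWc ω))) (aux _ hW)
  obtain ⟨i2, e2⟩ := integral_mul_sampling_of_nonneg hN hc (W := fun ω => max (-W ω) 0)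
    (fun _ => le_max_right _ _) (fun ω => max_le ((neg_le_abs _).trans (hWc ω))
      ((abs_nonneg _).trans (hWc ω))) (aux _ hWn)
  have hsplit : ∀ ω x, W ω * x = max (W ω) 0 * x - max (-W ω) 0 * x := fun ω x => by
    rw [← sub_mul, max_zero_sub_max_neg_zero_eq_self]
  have j1 : ∀ V : Ω → ℝ, Measurable V → (∀ ω, |V ω| ≤ c) →
      Integrable (fun ω => max (V ω) 0 * N ⊤ ω) P := fun V hV hb => by
    refine (hN.integrable ⊤).bdd_mul (c := c) (hV.max measurable_const).aestronglyMeasurable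
      (ae_of_all _ fun ω => ?_)
    rw [Real.norm_of_nonneg (le_max_right _ _)]
    exact max_le ((le_abs_self _).trans (hb ω)) ((abs_nonneg _).trans (hb ω))
  simp only [hsplit]
  refine ⟨i1.sub i2, ?_⟩
  have j2 := j1 (fun ω => -W ω) hWm.neg fun ω => by rw [abs_neg]; exact hWc ω
  rw [integral_sub i1 i2, integral_sub (j1 W hWm hWc) j2, e1, e2]

end Sampling

/-! ### Optional projection of progressive integrands -/

section Projection

variable {F : Filtration (Time T) mΩ} {P : Measure Ω} [IsFiniteMeasure P] {q : Time T → Ω → ℝ}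
  {κ : Kernel Ω (Time T)} [∀ ω, IsFiniteMeasure (κ ω)]

/-- The integrand is absorbed into the measure: `f κ` is again adapted, and of mass at most `c`. -/
lemma lintegral_progressive_mul_martingale_of_le (hq : Martingale q F P)
    (hc : ∀ ω u, ContinuousWithinAt (fun v => q v ω) (Ici u) u) (h0 : ∀ u ω, 0 ≤ q u ω)
    (hκ : IsAdaptedMeasure F κ) {f : Ω × Time T → ℝ≥0∞} (hf : IsProgressive F f)
    {c : ℝ≥0∞} (hc' : c ≠ ∞) (hfc : ∀ ω, ∫⁻ u, f (ω, u) ∂κ ω ≤ c) :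
    ∫⁻ ω, ∫⁻ u, f (ω, u) * ENNReal.ofReal (q u ω) ∂κ ω ∂P =
      ∫⁻ ω, ∫⁻ u, f (ω, u) * ENNReal.ofReal (q ⊤ ω) ∂κ ω ∂P := by
  let ν : Ω → Measure (Time T) := fun ω => (κ ω).withDensity fun u => f (ω, u)
  have hfin : ∀ ω, IsFiniteMeasure (ν ω) := fun ω =>
    isFiniteMeasure_withDensity (ne_top_of_le_ne_top hc' (hfc ω))
  have had : IsAdaptedMeasure F ν := hf.isAdaptedMeasure_withDensity hκ
  let κ' : Kernel Ω (Time T) := ⟨ν, had.measurable⟩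
  have : IsFiniteKernel κ' := ⟨⟨c, hc'.lt_top, fun ω => by
    change ν ω univ ≤ _
    simpa [ν] using hfc ω⟩⟩
  obtain ⟨h1, h2⟩ := integral_martingale_compProd (κ := κ') hq hc had
  have hqm : Measurable fun p : Ω × Time T => q p.2 p.1 :=
    (isProgressive_of_rightContinuous hq.1 hc).measurable
  have hqT : Measurable fun p : Ω × Time T => q ⊤ p.1 :=
    ((hq.1 ⊤).mono (F.le ⊤)).measurable.comp measurable_fst
  have hTi := integrable_compProd_fst (κ := κ') ((hq.1 ⊤).mono (F.le ⊤)) (hq.integrable ⊤)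
  have h3 := congrArg ENNReal.ofReal h2
  rw [ofReal_integral_eq_lintegral_ofReal h1 (ae_of_all _ fun p => h0 _ _),
    ofReal_integral_eq_lintegral_ofReal hTi (ae_of_all _ fun p => h0 _ _),
    Measure.lintegral_compProd hqm.ennreal_ofReal,
    Measure.lintegral_compProd hqT.ennreal_ofReal] at h3
  have h4 : ∀ g : Ω × Time T → ℝ, Measurable g → ∀ ω, ∫⁻ u, ENNReal.ofReal (g (ω, u)) ∂κ' ω =
      ∫⁻ u, f (ω, u) * ENNReal.ofReal (g (ω, u)) ∂κ ω := fun g hg ω => by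
    change ∫⁻ u, ENNReal.ofReal (g (ω, u)) ∂((κ ω).withDensity fun u => f (ω, u)) = _
    have h5 : Measurable fun u => f (ω, u) := hf.measurable.comp measurable_prodMk_left
    have h6 : Measurable fun u => ENNReal.ofReal (g (ω, u)) :=
      (hg.comp measurable_prodMk_left).ennreal_ofReal
    exact lintegral_withDensity_eq_lintegral_mul _ h5 h6
  simpa only [h4 _ hqm, h4 _ hqT] using h3

lemma lintegral_progressive_mul_martingale [IsSFiniteKernel κ] (hq : Martingale q F P)
    (hc : ∀ ω u, ContinuousWithinAt (fun v => q v ω) (Ici u) u) (h0 : ∀ u ω, 0 ≤ q u ω)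
    (hκ : IsAdaptedMeasure F κ) {f : Ω × Time T → ℝ≥0∞} (hf : IsProgressive F f) :
    ∫⁻ p, f p * ENNReal.ofReal (q p.2 p.1) ∂(P ⊗ₘ κ) =
      ∫⁻ p, f p * ENNReal.ofReal (q ⊤ p.1) ∂(P ⊗ₘ κ) := by
  -- The truncation caps `f` at `j` and kills it once `κ [0, u]` exceeds `j`. It stays progressive,
  -- its integral is at most `j * j`, and it increases to `f` because each `κ ω` is finite.
  let φ : ℕ → ℝ≥0∞ × ℝ≥0∞ → ℝ≥0∞ := fun j x => if x.2 ≤ j then min x.1 j else 0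
  have hφ : ∀ j, Measurable (φ j) := fun j =>
    Measurable.ite (measurableSet_le measurable_snd measurable_const)
      (measurable_fst.min measurable_const) measurable_const
  have hφm : ∀ x, Monotone fun j => φ j x := by
    intro x i j hij
    have hij' : (i : ℝ≥0∞) ≤ j := by exact_mod_cast hij
    simp only [φ]
    by_cases h : x.2 ≤ i
    · rw [if_pos h, if_pos (h.trans hij')]
      exact min_le_min_left _ hij'
    · rw [if_neg h]
      exact zero_le
  have hφt : ∀ x : ℝ≥0∞ × ℝ≥0∞, x.2 ≠ ∞ → Tendsto (fun j => φ j x) atTop (𝓝 x.1) := by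
    intro x hx
    have h1 : Tendsto (fun j : ℕ => min x.1 (j : ℝ≥0∞)) atTop (𝓝 (min x.1 ∞)) :=
      tendsto_const_nhds.min ENNReal.tendsto_nat_nhds_top
    rw [min_eq_left le_top] at h1
    obtain ⟨n, hn⟩ := ENNReal.exists_nat_gt hx
    refine h1.congr' ?_
    filter_upwards [eventually_ge_atTop n] with j hj
    have : x.2 ≤ j := hn.le.trans (by exact_mod_cast hj)
    simp only [φ, if_pos this]
  let g : Ω × Time T → ℝ≥0∞ × ℝ≥0∞ := fun p => (f p, κ p.1 (Iic p.2))
  have hg : IsProgressive F g := hf.prodMk hκ.isProgressive_Iic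
  have hfj : ∀ j, IsProgressive F fun p => φ j (g p) := fun j => hg.comp (hφ j)
  have hqm : Measurable fun p : Ω × Time T => q p.2 p.1 :=
    (isProgressive_of_rightContinuous hq.1 hc).measurable
  have hqT : Measurable fun p : Ω × Time T => q ⊤ p.1 :=
    ((hq.1 ⊤).mono (F.le ⊤)).measurable.comp measurable_fst
  have hlim : ∀ r : Ω × Time T → ℝ, Measurable r →
      Tendsto (fun j => ∫⁻ p, φ j (g p) * ENNReal.ofReal (r p) ∂(P ⊗ₘ κ)) atTop
        (𝓝 (∫⁻ p, f p * ENNReal.ofReal (r p) ∂(P ⊗ₘ κ))) := fun r hr =>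
    lintegral_tendsto_of_tendsto_of_monotone
      (fun j => ((hfj j).measurable.mul hr.ennreal_ofReal).aemeasurable)
      (ae_of_all _ fun p i j hij => by dsimp only; gcongr; exact hφm _ hij)
      (ae_of_all _ fun p => ENNReal.Tendsto.mul_const (hφt (g p) (measure_ne_top _ _))
        (Or.inr ENNReal.ofReal_ne_top))
  refine tendsto_nhds_unique (hlim _ hqm) ((hlim _ hqT).congr fun j => ?_)
  have hm : ∀ r : Ω × Time T → ℝ, Measurable r →
      Measurable fun p => φ j (g p) * ENNReal.ofReal (r p) := fun r hr =>
    (hfj j).measurable.mul hr.ennreal_ofReal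
  rw [Measure.lintegral_compProd (hm _ hqm), Measure.lintegral_compProd (hm _ hqT)]
  refine (lintegral_progressive_mul_martingale_of_le hq hc h0 hκ (hfj j)
    (c := j * j) (by finiteness) fun ω => ?_).symm
  calc ∫⁻ u, φ j (g (ω, u)) ∂κ ω
      ≤ ∫⁻ u, {u | κ ω (Iic u) ≤ j}.indicator (fun _ => (j : ℝ≥0∞)) u ∂κ ω := by
        refine lintegral_mono fun u => ?_
        by_cases h : κ ω (Iic u) ≤ j <;> simp [φ, g, h, indicator]
    _ ≤ j * κ ω {u | κ ω (Iic u) ≤ j} := lintegral_indicator_const_le _ _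
    _ ≤ j * j := by gcongr; exact measure_setOf_Iic_le _

/-- Signed version of `lintegral_progressive_mul_martingale`. -/
lemma integral_progressive_mul_martingale [IsSFiniteKernel κ] (hq : Martingale q F P)
    (hc : ∀ ω u, ContinuousWithinAt (fun v => q v ω) (Ici u) u) (h0 : ∀ u ω, 0 ≤ q u ω)
    (hκ : IsAdaptedMeasure F κ) {f : Ω × Time T → ℝ} (hf : IsProgressive F f)
    (hfi : Integrable (fun p => f p * q ⊤ p.1) (P ⊗ₘ κ)) :
    Integrable (fun p => f p * q p.2 p.1) (P ⊗ₘ κ) ∧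
      ∫ p, f p * q p.2 p.1 ∂(P ⊗ₘ κ) = ∫ p, f p * q ⊤ p.1 ∂(P ⊗ₘ κ) := by
  have hqm : Measurable fun p : Ω × Time T => q p.2 p.1 :=
    (isProgressive_of_rightContinuous hq.1 hc).measurable
  have hint : Integrable (fun p => f p * q p.2 p.1) (P ⊗ₘ κ) := by
    refine ⟨(hf.measurable.mul hqm).aestronglyMeasurable, ?_⟩
    have h1 := hfi.2
    rw [HasFiniteIntegral] at h1 ⊢
    simp only [enorm_mul, Real.enorm_eq_ofReal (h0 _ _)] at h1 ⊢
    rwa [lintegral_progressive_mul_martingale hq hc h0 hκ (hf.comp measurable_enorm)]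
  refine ⟨hint, ?_⟩
  rw [integral_eq_lintegral_pos_part_sub_lintegral_neg_part hint,
    integral_eq_lintegral_pos_part_sub_lintegral_neg_part hfi]
  simp only [← neg_mul, ENNReal.ofReal_mul' (h0 _ _)]
  rw [lintegral_progressive_mul_martingale hq hc h0 hκ (hf.comp ENNReal.measurable_ofReal),
    lintegral_progressive_mul_martingale hq hc h0 hκ
      (hf.comp (g := fun x => ENNReal.ofReal (-x)) (by fun_prop))]

/-- If `∫ f q_u dκ` is finite, so is `∫ f dκ` wherever the nonnegative martingale `q` does not end
at zero. -/
lemma lintegral_lt_top_of_martingale_pos [IsSFiniteKernel κ] (hq : Martingale q F P)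
    (hc : ∀ ω u, ContinuousWithinAt (fun v => q v ω) (Ici u) u) (h0 : ∀ u ω, 0 ≤ q u ω)
    (hκ : IsAdaptedMeasure F κ) {f : Ω × Time T → ℝ≥0∞} (hf : IsProgressive F f)
    (hfin : ∀ᵐ ω ∂P, ∫⁻ u, f (ω, u) * ENNReal.ofReal (q u ω) ∂κ ω < ∞) :
    ∀ᵐ ω ∂P, 0 < q ⊤ ω → ∫⁻ u, f (ω, u) ∂κ ω < ∞ := by
  have hqp := isProgressive_of_rightContinuous hq.1 hc
  -- Cutting `f` where the running integral `U` exceeds `j` bounds `∫ f q_u dκ` by `j`. Projection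
  -- turns `q_u` into `q ⊤`, which then factors out of the integral. Almost every path has `U`
  -- bounded, so for some `j` nothing is cut.
  let U : Ω × Time T → ℝ≥0∞ := fun p =>
    ∫⁻ u in Iic p.2, f (p.1, u) * ENNReal.ofReal (q u p.1) ∂κ p.1
  have hfq : IsProgressive F fun p => f p * ENNReal.ofReal (q p.2 p.1) :=
    (hf.prodMk hqp).comp (g := fun x => x.1 * ENNReal.ofReal x.2) (by fun_prop)
  have hU : IsProgressive F U := hfq.setLIntegral_Iic hκ
  have hfj : ∀ j : ℕ, IsProgressive F fun p => if U p ≤ j then f p else 0 := fun j =>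
    (hf.prodMk hU).comp (g := fun x : ℝ≥0∞ × ℝ≥0∞ => if x.2 ≤ (j : ℝ≥0∞) then x.1 else 0)
      (Measurable.ite (measurableSet_le measurable_snd measurable_const) measurable_fst
        measurable_const)
  have hqT : Measurable fun p : Ω × Time T => q ⊤ p.1 :=
    ((hq.1 ⊤).mono (F.le ⊤)).measurable.comp measurable_fst
  have hj : ∀ j : ℕ, ∀ᵐ ω ∂P,
      ∫⁻ u, (if U (ω, u) ≤ j then f (ω, u) else 0) * ENNReal.ofReal (q ⊤ ω) ∂κ ω < ∞ := by
    intro j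
    have h1 := lintegral_progressive_mul_martingale (P := P) hq hc h0 hκ (hfj j)
    have hm : ∀ r : Ω × Time T → ℝ, Measurable r →
        Measurable fun p => (if U p ≤ j then f p else 0) * ENNReal.ofReal (r p) := fun r hr =>
      (hfj j).measurable.mul hr.ennreal_ofReal
    rw [Measure.lintegral_compProd (hm _ hqp.measurable),
      Measure.lintegral_compProd (hm _ hqT)] at h1
    refine ae_lt_top ?_ (ne_top_of_le_ne_top (b := j * P univ) (by finiteness) ?_)
    · exact (hm _ hqT).lintegral_kernel_prod_right' (κ := κ)
    · rw [← h1, ← lintegral_const]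
      refine lintegral_mono fun ω => ?_
      let ν := (κ ω).withDensity fun u => f (ω, u) * ENNReal.ofReal (q u ω)
      have hν : ∀ u, ν (Iic u) = U (ω, u) := fun u => withDensity_apply _ measurableSet_Iic
      calc ∫⁻ u, (if U (ω, u) ≤ j then f (ω, u) else 0) * ENNReal.ofReal (q u ω) ∂κ ω
          = ∫⁻ u in {u | ν (Iic u) ≤ j}, f (ω, u) * ENNReal.ofReal (q u ω) ∂κ ω := by
            have hm : MeasurableSet {u | ν (Iic u) ≤ j} := by
              simp only [hν]
              exact measurableSet_le (hU.measurable.comp measurable_prodMk_left) measurable_const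
            rw [← lintegral_indicator hm]
            refine lintegral_congr fun u => ?_
            by_cases h : U (ω, u) ≤ j <;> simp [h, hν, indicator]
        _ ≤ ν {u | ν (Iic u) ≤ j} := withDensity_apply_le _ _
        _ ≤ j := measure_setOf_Iic_le _
  filter_upwards [ae_all_iff.2 hj, hfin] with ω h1 h2 hpos
  obtain ⟨n, hn⟩ := ENNReal.exists_nat_gt h2.ne
  have hle : ∀ u, U (ω, u) ≤ n := fun u => (setLIntegral_le_lintegral _ _).trans hn.le
  have h3 := h1 n
  simp only [hle, if_true] at h3
  rw [lintegral_mul_const' _ _ ENNReal.ofReal_ne_top] at h3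
  exact ENNReal.lt_top_of_mul_ne_top_left h3.ne (ENNReal.ofReal_pos.2 hpos).ne'

end Projection

/-! ### Stopping between two deterministic times -/

lemma measurable_min_of_measurableSet_le {F : Filtration (Time T) mΩ} {θ : Ω → Time T}
    (hθ : ∀ r, MeasurableSet[F r] {ω | θ ω ≤ r}) (t : Time T) :
    Measurable[F t] fun ω => min (θ ω) t := by
  refine measurable_of_Iic fun r => ?_
  rcases le_or_gt t r with htr | htr
  · convert @MeasurableSet.univ _ (F t)
    ext ω
    simp [htr]
  · convert F.mono htr.le _ (hθ r) using 1
    ext ω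
    simp [htr.not_ge]

/-- For `r < s` the function vanishes, since `θ ≥ s` on `B`; for `r ≥ s` the event `B` already
belongs to `F r`. This makes it an admissible weight for `integral_mul_sampling`. -/
lemma measurable_indicator_stopped {F : Filtration (Time T) mΩ} {θ : Ω → Time T}
    (hθ : ∀ r, MeasurableSet[F r] {ω | θ ω ≤ r}) {s : Time T} {B : Set Ω}
    (hB : MeasurableSet[F s] B) (hsθ : ∀ ω ∈ B, s ≤ θ ω) {X : Ω × Time T → ℝ}
    (hX : IsProgressive F X) (r : Time T) :
    Measurable[F r] ({ω | θ ω ≤ r}.indicator (B.indicator fun ω => X (ω, θ ω))) := by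
  rcases lt_or_ge r s with hrs | hrs
  · have : ({ω | θ ω ≤ r}.indicator (B.indicator fun ω => X (ω, θ ω))) = fun _ => 0 := by
      ext ω
      by_cases h : ω ∈ B
      · have : ¬ θ ω ≤ r := not_le.2 (hrs.trans_le (hsθ ω h))
        simp [indicator, this]
      · simp [indicator, h]
    rw [this]
    exact @measurable_const _ _ _ (F r) 0
  · have h1 : Measurable[F r] fun ω => X (ω, min (min (θ ω) r) r) :=
      (hX r).comp (Measurable.prodMk (m := F r) (@measurable_id _ (F r))
        (measurable_min_of_measurableSet_le hθ r))
    convert h1.indicator ((hθ r).inter (F.mono hrs _ hB)) using 1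
    ext ω
    by_cases h : θ ω ≤ r <;> by_cases h' : ω ∈ B <;> simp [indicator, h, h']

lemma IsProgressive.indicator_Ioc {F : Filtration (Time T) mΩ} {θ : Ω → Time T}
    (hθ : ∀ r, MeasurableSet[F r] {ω | θ ω ≤ r}) {s : Time T} {B : Set Ω}
    (hB : MeasurableSet[F s] B) {X : Ω × Time T → ℝ} (hX : IsProgressive F X) :
    IsProgressive F ({p | p.1 ∈ B ∧ p.2 ∈ Ioc s (θ p.1)}.indicator X) := by
  intro t
  rcases le_or_gt t s with hts | hts
  · convert @measurable_const ℝ _ _ ((F t).prod inferInstance) 0 using 1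
    ext p
    refine indicator_of_notMem (fun h => ?_) _
    exact absurd (h.2.1.trans_le (min_le_right _ _)) hts.not_gt
  · have h1 : @Measurable _ _ ((F t).prod inferInstance) _ fun p : Ω × Time T => min p.2 t :=
      (measurable_id.min measurable_const).comp (@measurable_snd _ _ (F t) _)
    have h2 : @Measurable _ _ ((F t).prod inferInstance) _ fun p : Ω × Time T => min (θ p.1) t :=
      (measurable_min_of_measurableSet_le hθ t).comp (@measurable_fst _ _ (F t) _)
    have h4 : MeasurableSet[(F t).prod inferInstance]
        {p : Ω × Time T | min p.2 t ≤ min (θ p.1) t} := measurableSet_le (α := Time T) h1 h2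
    have h3 : MeasurableSet[(F t).prod inferInstance]
        {p : Ω × Time T | p.1 ∈ B ∧ s < min p.2 t ∧ min p.2 t ≤ min (θ p.1) t} :=
      ((@measurable_fst Ω (Time T) (F t) _) (F.mono hts.le _ hB)).inter
        ((h1 measurableSet_Ioi).inter h4)
    convert (hX t).indicator h3 using 1
    ext p
    have : (p.1 ∈ B ∧ min p.2 t ∈ Ioc s (θ p.1)) ↔
        (p.1 ∈ B ∧ s < min p.2 t ∧ min p.2 t ≤ min (θ p.1) t) := by
      rw [le_min_iff, mem_Ioc]
      simp
    by_cases h : (p.1 ∈ B ∧ min p.2 t ∈ Ioc s (θ p.1))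
    · exact (indicator_of_mem (s := {p : Ω × Time T | p.1 ∈ B ∧ p.2 ∈ Ioc s (θ p.1)})
        (a := (p.1, min p.2 t)) h X).trans (indicator_of_mem (s := {p : Ω × Time T | p.1 ∈ B ∧
          s < min p.2 t ∧ min p.2 t ≤ min (θ p.1) t}) (a := p) (this.1 h)
          fun p => X (p.1, min p.2 t)).symm
    · exact (indicator_of_notMem (s := {p : Ω × Time T | p.1 ∈ B ∧ p.2 ∈ Ioc s (θ p.1)})
        (a := (p.1, min p.2 t)) h X).trans (indicator_of_notMem (s := {p : Ω × Time T | p.1 ∈ B ∧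
          s < min p.2 t ∧ min p.2 t ≤ min (θ p.1) t}) (a := p)
          (fun h' => h (this.2 h')) fun p => X (p.1, min p.2 t)).symm

section Girsanov

variable {F : Filtration (Time T) mΩ} {P : Measure Ω} [IsFiniteMeasure P]
  {q N M : Time T → Ω → ℝ} {κ : Kernel Ω (Time T)} [∀ ω, IsFiniteMeasure (κ ω)]
  [IsSFiniteKernel κ]

/-- Girsanov's theorem in integrated form, between `s` and a bounded time `θ`. The three terms
carrying `q ⊤` are rewritten with `q` at times `θ`, `s` and `u`; on `B` they then add up to `N_θ -
N_s`, of mean zero by optional sampling. -/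
lemma integral_density_mul_increment_eq_zero (hq : Martingale q F P)
    (hc : ∀ ω u, ContinuousWithinAt (fun v => q v ω) (Ici u) u) (h0 : ∀ u ω, 0 ≤ q u ω)
    (hN : Martingale N F P) (hNc : ∀ ω u, ContinuousWithinAt (fun v => N v ω) (Ici u) u)
    (hκ : IsAdaptedMeasure F κ) (hM : IsProgressive F fun p => M p.2 p.1)
    {K : Ω × Time T → ℝ} (hK : IsProgressive F K) {θ : Ω → Time T}
    (hθ : ∀ r, MeasurableSet[F r] {ω | θ ω ≤ r}) {s : Time T} {B : Set Ω}
    (hB : MeasurableSet[F s] B) (hsθ : ∀ ω ∈ B, s ≤ θ ω) {c : ℝ} (hc0 : 0 ≤ c)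
    (hMs : ∀ ω ∈ B, |M s ω| ≤ c) (hMθ : ∀ ω ∈ B, |M (θ ω) ω| ≤ c)
    (hKc : ∀ ω ∈ B, ∫⁻ u in Ioc s (θ ω), ‖K (ω, u)‖ₑ ∂κ ω ≤ ENNReal.ofReal c)
    (hNM : ∀ᵐ ω ∂P, ω ∈ B → N (θ ω) ω - N s ω = q (θ ω) ω * M (θ ω) ω - q s ω * M s ω -
      ∫ u in Ioc s (θ ω), K (ω, u) * q u ω ∂κ ω) :
    Integrable (B.indicator fun ω =>
        q ⊤ ω * (M (θ ω) ω - M s ω - ∫ u in Ioc s (θ ω), K (ω, u) ∂κ ω)) P ∧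
      ∫ ω, B.indicator (fun ω =>
        q ⊤ ω * (M (θ ω) ω - M s ω - ∫ u in Ioc s (θ ω), K (ω, u) ∂κ ω)) ω ∂P = 0 := by
  classical
  have hBm := F.le _ _ hB
  have hs : ∀ r, MeasurableSet[F r] {_ω : Ω | s ≤ r} := fun r =>
    @MeasurableSet.const _ (F r) (s ≤ r)
  have h1p : IsProgressive F fun _ : Ω × Time T => (1 : ℝ) := fun t =>
    @measurable_const _ _ _ ((F t).prod inferInstance) _
  have bnd : ∀ X : Ω → ℝ, ∀ b, 0 ≤ b → (∀ ω ∈ B, |X ω| ≤ b) → ∀ ω, |B.indicator X ω| ≤ b := by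
    intro X b hb hX ω
    by_cases h : ω ∈ B
    · simpa [h] using hX ω h
    · simpa [h] using hb
  obtain ⟨i1, e1⟩ := integral_mul_sampling hq hc (bnd _ c hc0 hMθ)
    (measurable_indicator_stopped hθ hB hsθ hM)
  obtain ⟨i2, e2⟩ := integral_mul_sampling hq hc (θ := fun _ => s) (bnd _ c hc0 hMs)
    (measurable_indicator_stopped (θ := fun _ => s) hs hB (fun _ _ => le_rfl) hM)
  obtain ⟨i3, e3⟩ := integral_mul_sampling hN hNc (bnd (fun _ => 1) 1 zero_le_one (by simp))
    (measurable_indicator_stopped hθ hB hsθ h1p)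
  obtain ⟨i4, e4⟩ := integral_mul_sampling hN hNc (θ := fun _ => s)
    (bnd (fun _ => 1) 1 zero_le_one (by simp))
    (measurable_indicator_stopped (θ := fun _ => s) hs hB (fun _ _ => le_rfl) h1p)
  -- Putting the event and the random interval into the integrand keeps it progressive, so the
  -- projection identity applies over the whole of `[0, T]`.
  set f : Ω × Time T → ℝ := {p | p.1 ∈ B ∧ p.2 ∈ Ioc s (θ p.1)}.indicator K with hf
  have hfp : IsProgressive F f := hK.indicator_Ioc hθ hB
  have hfB : ∀ ω ∈ B, ∀ u, f (ω, u) = (Ioc s (θ ω)).indicator (fun u => K (ω, u)) u := by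
    intro ω hω u
    by_cases h : u ∈ Ioc s (θ ω)
    · rw [indicator_of_mem h]
      exact indicator_of_mem (s := {p : Ω × Time T | p.1 ∈ B ∧ p.2 ∈ Ioc s (θ p.1)}) ⟨hω, h⟩ K
    · rw [indicator_of_notMem h]
      exact indicator_of_notMem (s := {p : Ω × Time T | p.1 ∈ B ∧ p.2 ∈ Ioc s (θ p.1)})
        (fun h' => h h'.2) K
  have hfB' : ∀ ω ∉ B, ∀ u, f (ω, u) = 0 := fun ω hω u =>
    indicator_of_notMem (fun h => hω h.1) _
  have hqm : Measurable fun p : Ω × Time T => q ⊤ p.1 :=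
    ((hq.1 ⊤).mono (F.le ⊤)).measurable.comp measurable_fst
  have hfi : Integrable (fun p => f p * q ⊤ p.1) (P ⊗ₘ κ) := by
    have hm : Measurable fun p : Ω × Time T => f p * q ⊤ p.1 := hfp.measurable.mul hqm
    refine ⟨hm.aestronglyMeasurable, ?_⟩
    rw [HasFiniteIntegral, Measure.lintegral_compProd hm.enorm]
    have hle : ∀ ω, ∫⁻ u, ‖f (ω, u) * q ⊤ ω‖ₑ ∂κ ω ≤ ENNReal.ofReal c * ‖q ⊤ ω‖ₑ := by
      intro ω
      simp only [enorm_mul]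
      rw [lintegral_mul_const' _ _ enorm_ne_top]
      gcongr
      by_cases h : ω ∈ B
      · refine le_trans (le_of_eq ?_) (hKc ω h)
        rw [← lintegral_indicator measurableSet_Ioc]
        refine lintegral_congr fun u => ?_
        rw [hfB ω h, enorm_indicator_eq_indicator_enorm]
      · simp [hfB' ω h]
    refine (lintegral_mono hle).trans_lt ?_
    rw [lintegral_const_mul' _ _ ENNReal.ofReal_ne_top]
    exact ENNReal.mul_lt_top ENNReal.ofReal_lt_top (hq.integrable ⊤).2
  obtain ⟨i5, e5⟩ := integral_progressive_mul_martingale hq hc h0 hκ hfp hfi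
  have i5' : Integrable (fun ω => ∫ u, f (ω, u) * q u ω ∂κ ω) P := by
    simpa only [Kernel.prodMkLeft_apply, Kernel.const_apply] using i5.integral_compProd
  have i6 : Integrable (fun ω => ∫ u, f (ω, u) * q ⊤ ω ∂κ ω) P := by
    simpa only [Kernel.prodMkLeft_apply, Kernel.const_apply] using hfi.integral_compProd
  rw [Measure.integral_compProd i5, Measure.integral_compProd hfi] at e5
  have j1 : ∀ X : Ω → ℝ, Integrable X P → ∀ V : Ω → ℝ, Measurable (B.indicator V) →
      ∀ b, (∀ ω, |B.indicator V ω| ≤ b) → Integrable (fun ω => B.indicator V ω * X ω) P :=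
    fun X hX V hV b hb => hX.bdd_mul (c := b) hV.aestronglyMeasurable (ae_of_all _ hb)
  have m1 : Measurable (B.indicator fun ω => M (θ ω) ω) := by
    have := (measurable_indicator_stopped hθ hB hsθ hM ⊤).mono (F.le ⊤) le_rfl
    simpa using this
  have m2 : Measurable (B.indicator fun ω => M s ω) :=
    ((hM.measurable_apply s).mono (F.le s) le_rfl).indicator hBm
  have k1 := j1 _ (hq.integrable ⊤) _ m1 c (bnd _ c hc0 hMθ)
  have k2 := j1 _ (hq.integrable ⊤) _ m2 c (bnd _ c hc0 hMs)
  have hX : (B.indicator fun ω =>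
      q ⊤ ω * (M (θ ω) ω - M s ω - ∫ u in Ioc s (θ ω), K (ω, u) ∂κ ω)) =
      fun ω => B.indicator (fun ω => M (θ ω) ω) ω * q ⊤ ω - B.indicator (fun ω => M s ω) ω * q ⊤ ω -
        ∫ u, f (ω, u) * q ⊤ ω ∂κ ω := by
    ext ω
    by_cases h : ω ∈ B
    · simp only [indicator_of_mem h, hfB ω h]
      rw [integral_mul_const, integral_indicator measurableSet_Ioc]
      ring
    · simp [h, hfB' ω h]
  rw [hX]
  refine ⟨(k1.sub k2).sub i6, ?_⟩
  have e7 := integral_sub (k1.sub k2) i6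
  simp only [Pi.sub_apply] at e7
  have e8 := integral_sub (i1.sub i2) i5'
  simp only [Pi.sub_apply] at e8
  simp only [e7]
  -- Here `q ⊤` is replaced by `q_θ`, `q_s` and `q_u`.
  rw [integral_sub k1 k2, ← e1, ← e2, ← e5, ← integral_sub i1 i2, ← e8]
  have e6 : ∫ ω, B.indicator (fun _ => (1 : ℝ)) ω * N (θ ω) ω -
      B.indicator (fun _ => (1 : ℝ)) ω * N s ω ∂P = 0 := by
    rw [integral_sub i3 i4, e3, e4, sub_self]
  rw [← e6]
  refine integral_congr_ae ?_
  filter_upwards [hNM] with ω hω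
  by_cases h : ω ∈ B
  · have hω' := hω h
    have : ∫ u, f (ω, u) * q u ω ∂κ ω = ∫ u in Ioc s (θ ω), K (ω, u) * q u ω ∂κ ω := by
      rw [← integral_indicator measurableSet_Ioc]
      refine integral_congr_ae (ae_of_all _ fun u => ?_)
      simp only [hfB ω h]
      by_cases hu : u ∈ Ioc s (θ ω) <;> simp [hu]
    simp only [indicator_of_mem h, this, one_mul]
    linarith
  · simp [h, hfB' ω h]

end Girsanov

/-! ### Capped times -/

/-- The time `t ∧ σ`. -/
def capTime (σ : WithTop (Time T)) (t : Time T) : Time T := (min (t : WithTop (Time T)) σ).untopA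

lemma coe_capTime (σ : WithTop (Time T)) (t : Time T) :
    (capTime σ t : WithTop (Time T)) = min (t : WithTop (Time T)) σ := by
  have h : min (t : WithTop (Time T)) σ ≠ ⊤ :=
    ne_top_of_le_ne_top WithTop.coe_ne_top (min_le_left _ _)
  rw [capTime, WithTop.untopA_eq_untop h, WithTop.coe_untop]

lemma capTime_le (σ : WithTop (Time T)) (t : Time T) : capTime σ t ≤ t :=
  WithTop.coe_le_coe.1 ((coe_capTime σ t).trans_le (min_le_left _ _))

lemma coe_capTime_le (σ : WithTop (Time T)) (t : Time T) :
    (capTime σ t : WithTop (Time T)) ≤ σ :=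
  (coe_capTime σ t).trans_le (min_le_right _ _)

lemma le_capTime_iff {σ : WithTop (Time T)} {s t : Time T} :
    s ≤ capTime σ t ↔ s ≤ t ∧ (s : WithTop (Time T)) ≤ σ := by
  rw [← WithTop.coe_le_coe, coe_capTime, le_min_iff, WithTop.coe_le_coe]

lemma capTime_le_iff {σ : WithTop (Time T)} {r t : Time T} :
    capTime σ t ≤ r ↔ t ≤ r ∨ σ ≤ (r : WithTop (Time T)) := by
  rw [← WithTop.coe_le_coe, coe_capTime, min_le_iff, WithTop.coe_le_coe]

lemma capTime_of_le {σ : WithTop (Time T)} {t : Time T} (h : (t : WithTop (Time T)) ≤ σ) :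
    capTime σ t = t :=
  le_antisymm (capTime_le _ _) (le_capTime_iff.2 ⟨le_rfl, h⟩)

@[simp] lemma capTime_coe (r t : Time T) : capTime (r : WithTop (Time T)) t = min t r :=
  eq_of_forall_le_iff fun s => by rw [le_capTime_iff, le_min_iff, WithTop.coe_le_coe]

lemma capTime_eq_of_le_of_le {σ : WithTop (Time T)} {s t : Time T} (hst : s ≤ t)
    (h : σ ≤ (s : WithTop (Time T))) : capTime σ t = capTime σ s :=
  eq_of_forall_le_iff fun r => by
    simp only [le_capTime_iff, and_congr_left_iff]
    intro hr
    have : r ≤ s := WithTop.coe_le_coe.1 (hr.trans h)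
    exact ⟨fun _ => this, fun _ => this.trans hst⟩

lemma continuous_capTime (σ : WithTop (Time T)) : Continuous (capTime σ) := by
  induction σ with
  | top =>
    have : capTime (⊤ : WithTop (Time T)) = id := funext fun t => capTime_of_le le_top
    rw [this]
    exact continuous_id
  | coe r =>
    have : capTime (r : WithTop (Time T)) = fun t => min t r := funext fun t => capTime_coe r t
    rw [this]
    exact continuous_id.min continuous_const

lemma monotone_capTime (σ : WithTop (Time T)) : Monotone (capTime σ) := fun _ _ h =>
  le_capTime_iff.2 ⟨(capTime_le _ _).trans h, coe_capTime_le _ _⟩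

lemma measurableSet_capTime_le {F : Filtration (Time T) mΩ} {σ : Ω → WithTop (Time T)}
    (hσ : IsStoppingTime F σ) (t r : Time T) :
    MeasurableSet[F r] {ω | capTime (σ ω) t ≤ r} := by
  simp only [capTime_le_iff]
  exact (@MeasurableSet.const _ (F r) (t ≤ r)).union (hσ r)

lemma measurable_capTime {F : Filtration (Time T) mΩ} {σ : Ω → WithTop (Time T)}
    (hσ : IsStoppingTime F σ) (t : Time T) : Measurable[F t] fun ω => capTime (σ ω) t := by
  have h := measurable_min_of_measurableSet_le (measurableSet_capTime_le hσ t) t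
  simpa only [min_eq_left (capTime_le _ t)] using h

/-! ### Filtrations containing the null sets -/

lemma UsualConditions.measurableSet {F : Filtration (Time T) mΩ} {P : Measure Ω}
    (hF : UsualConditions F P) {S : Set Ω} (hS : P Sᶜ = 0) (t : Time T) : MeasurableSet[F t] S :=
  F.mono bot_le _ (@MeasurableSet.of_compl _ _ (F ⊥) (hF.complete _ hS))

/-- Zeroing the bad paths makes almost sure right-continuity hold everywhere, as the sampling lemmas
require; adaptedness survives because `F` contains the null sets. -/
lemma martingale_indicator_of_ae {F : Filtration (Time T) mΩ} {P : Measure Ω}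
    (hF : UsualConditions F P) {X : Time T → Ω → ℝ} (hX : Martingale X F P) {G : Set Ω}
    (hG : ∀ᵐ ω ∂P, ω ∈ G) : Martingale (fun t => G.indicator (X t)) F P := by
  have hae : ∀ t, G.indicator (X t) =ᵐ[P] X t := fun t => by
    filter_upwards [hG] with ω hω using indicator_of_mem hω _
  refine ⟨fun t => (hX.1 t).indicator (hF.measurableSet hG t), fun s t hst => ?_⟩
  exact (condExp_congr_ae (hae t)).trans ((hX.2 s t hst).trans (hae s).symm)

/-! ### Stopped compensated processes -/

/-- The process `1_{σ > 0} (M - ∫ K dκ)^σ`. -/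
def stoppedCompensated (κ : Ω → Measure (Time T)) (M : Time T → Ω → ℝ) (K : Ω × Time T → ℝ)
    (σ : Ω → WithTop (Time T)) (t : Time T) (ω : Ω) : ℝ :=
  {ω | ⊥ < σ ω}.indicator
    (fun ω => M (capTime (σ ω) t) ω - ∫ u in Iic (capTime (σ ω) t), K (ω, u) ∂κ ω) ω

/-- Up to the time `σ`, if positive, `|M|` and `∫ |K| dκ` are bounded by `c`. -/
def IsBoundingTime (κ : Ω → Measure (Time T)) (M : Time T → Ω → ℝ) (K : Ω × Time T → ℝ) (c : ℝ)
    (σ : Ω → WithTop (Time T)) : Prop :=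
  ∀ ω, ⊥ < σ ω → ∀ u : Time T, (u : WithTop (Time T)) ≤ σ ω →
    |M u ω| ≤ c ∧ ∫⁻ s in Iic u, ‖K (ω, s)‖ₑ ∂κ ω ≤ ENNReal.ofReal c

section Bounding

variable {κ : Ω → Measure (Time T)} {M : Time T → Ω → ℝ} {K : Ω × Time T → ℝ} {c : ℝ}
  {σ : Ω → WithTop (Time T)}

lemma IsBoundingTime.integrableOn (hσ : IsBoundingTime κ M K c σ) (hK : Measurable K) {ω : Ω}
    (h : ⊥ < σ ω) {u : Time T} (hu : (u : WithTop (Time T)) ≤ σ ω) :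
    IntegrableOn (fun s => K (ω, s)) (Iic u) (κ ω) :=
  ⟨(hK.comp measurable_prodMk_left).aestronglyMeasurable,
    (hσ ω h u hu).2.trans_lt ENNReal.ofReal_lt_top⟩

lemma abs_setIntegral_le_of_lintegral {μ : Measure (Time T)} {S : Set (Time T)} {f : Time T → ℝ}
    (hc : 0 ≤ c) (h : ∫⁻ s in S, ‖f s‖ₑ ∂μ ≤ ENNReal.ofReal c) : |∫ s in S, f s ∂μ| ≤ c := by
  have h1 := (enorm_integral_le_lintegral_enorm (μ := μ.restrict S) f).trans h
  rw [Real.enorm_eq_ofReal_abs] at h1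
  exact (ENNReal.ofReal_le_ofReal_iff hc).1 h1

lemma IsBoundingTime.abs_stoppedCompensated_le (hσ : IsBoundingTime κ M K c σ) (hc : 0 ≤ c)
    (t : Time T) (ω : Ω) : |stoppedCompensated κ M K σ t ω| ≤ 2 * c := by
  rw [stoppedCompensated]
  by_cases h : ⊥ < σ ω
  · rw [indicator_of_mem (show ω ∈ {ω | ⊥ < σ ω} from h)]
    obtain ⟨h1, h2⟩ := hσ ω h _ (coe_capTime_le _ t)
    have h3 := abs_setIntegral_le_of_lintegral hc h2
    have := abs_sub (M (capTime (σ ω) t) ω) (∫ u in Iic (capTime (σ ω) t), K (ω, u) ∂κ ω)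
    linarith
  · rw [indicator_of_notMem (show ω ∉ {ω | ⊥ < σ ω} from h), abs_zero]
    positivity

lemma stoppedCompensated_sub_of_lt (hσ : IsBoundingTime κ M K c σ) (hK : Measurable K)
    {s t : Time T} (hst : s ≤ t) {ω : Ω} (h : (s : WithTop (Time T)) < σ ω) :
    stoppedCompensated κ M K σ t ω - stoppedCompensated κ M K σ s ω =
      M (capTime (σ ω) t) ω - M s ω - ∫ u in Ioc s (capTime (σ ω) t), K (ω, u) ∂κ ω := by
  have hpos : ⊥ < σ ω := bot_le.trans_lt h
  have hle : s ≤ capTime (σ ω) t := le_capTime_iff.2 ⟨hst, h.le⟩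
  have hi := hσ.integrableOn hK hpos (coe_capTime_le (σ ω) t)
  rw [stoppedCompensated, stoppedCompensated, indicator_of_mem (show ω ∈ {ω | ⊥ < σ ω} from hpos),
    indicator_of_mem (show ω ∈ {ω | ⊥ < σ ω} from hpos), capTime_of_le h.le,
    ← Iic_union_Ioc_eq_Iic hle, setIntegral_union (Iic_disjoint_Ioc le_rfl) measurableSet_Ioc
      (hi.mono_set (Iic_subset_Iic.2 hle)) (hi.mono_set Ioc_subset_Iic_self)]
  ring

lemma stoppedCompensated_eq_of_le {s t : Time T} (hst : s ≤ t) {ω : Ω}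
    (h : σ ω ≤ (s : WithTop (Time T))) :
    stoppedCompensated κ M K σ t ω = stoppedCompensated κ M K σ s ω := by
  simp only [stoppedCompensated, indicator, capTime_eq_of_le_of_le hst h]

end Bounding

/-! ### The density times the stopped compensated process is a martingale -/

/-- The value `⊤` is isolated: it is the only point above `T`. -/
lemma eventually_eq_top_of_tendsto {τ : ℕ → WithTop (Time T)} (h : Tendsto τ atTop (𝓝 ⊤)) :
    ∀ᶠ m in atTop, τ m = ⊤ := by
  filter_upwards [h.eventually (Ioi_mem_nhds (WithTop.coe_lt_top (⊤ : Time T)))] with m hm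
  by_contra hne
  obtain ⟨u, hu⟩ := WithTop.ne_top_iff_exists.1 hne
  rw [← hu] at hm
  exact absurd (WithTop.coe_lt_coe.1 hm) (not_lt.2 le_top)

section Girsanov

variable {F : Filtration (Time T) mΩ} {P : Measure Ω} [IsFiniteMeasure P]
  {q N M : Time T → Ω → ℝ} {κ : Kernel Ω (Time T)} [∀ ω, IsFiniteMeasure (κ ω)]
  [IsSFiniteKernel κ] {K : Ω × Time T → ℝ} {σ : Ω → WithTop (Time T)} {c : ℝ}

/-- The bounded-time identity is applied up to `t ∧ σ ∧ ρ m`, where `ρ` localizes `N`. Since `σ`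
controls `M` and `∫ |K| dκ`, the localization is removed by dominated convergence. -/
theorem setIntegral_density_mul_stoppedCompensated (hF : UsualConditions F P)
    (hq : Martingale q F P)
    (hc : ∀ ω u, ContinuousWithinAt (fun v => q v ω) (Ici u) u) (h0 : ∀ u ω, 0 ≤ q u ω)
    (hκ : IsAdaptedMeasure F κ) (hM : IsProgressive F fun p => M p.2 p.1)
    (hK : IsProgressive F K) (hσ : IsStoppingTime F σ) (hc0 : 0 ≤ c)
    (hσb : IsBoundingTime κ M K c σ) (hN : IsLocalMartingale F P N)
    (hNM : ∀ᵐ ω ∂P, Integrable (fun u => K (ω, u) * q u ω) (κ ω) ∧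
      ∀ t, N t ω = q t ω * M t ω - ∫ u in Iic t, K (ω, u) * q u ω ∂κ ω)
    {s t : Time T} (hst : s ≤ t) {A : Set Ω} (hA : MeasurableSet[F s] A) :
    ∫ ω in A, q ⊤ ω *
      (stoppedCompensated κ M K σ t ω - stoppedCompensated κ M K σ s ω) ∂P = 0 := by
  obtain ⟨ρ, hρ, hρM⟩ := hN.locally_martingale
  set G : Set Ω := {ω | ∀ u, ContinuousWithinAt (fun v => N v ω) (Ici u) u} with hGdef
  have hG : ∀ᵐ ω ∂P, ω ∈ G := by
    filter_upwards [hN.cadlag] with ω hω u using (hω u).1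
  let θ : ℕ → Ω → Time T := fun m ω => capTime (min (σ ω) (ρ m ω)) t
  -- Restricting to `s < σ` loses nothing, because the stopped process does not move after `σ`.
  -- Restricting to `s < ρ m` loses nothing in the limit, because `ρ m` is eventually `⊤`.
  let B : ℕ → Set Ω := fun m =>
    A ∩ {ω | (s : WithTop (Time T)) < σ ω} ∩ {ω | (s : WithTop (Time T)) < ρ m ω}
  have hB : ∀ m, MeasurableSet[F s] (B m) := fun m =>
    (hA.inter (hσ.measurableSet_gt s)).inter ((hρ.isStoppingTime m).measurableSet_gt s)
  have hθ : ∀ m r, MeasurableSet[F r] {ω | θ m ω ≤ r} := fun m r =>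
    measurableSet_capTime_le (hσ.min (hρ.isStoppingTime m)) t r
  have hsθ : ∀ m, ∀ ω ∈ B m, s ≤ θ m ω := fun m ω hω =>
    le_capTime_iff.2 ⟨hst, le_min hω.1.2.le hω.2.le⟩
  have hθσ : ∀ m ω, (θ m ω : WithTop (Time T)) ≤ σ ω := fun m ω =>
    (coe_capTime_le _ _).trans (min_le_left _ _)
  have hpos : ∀ m, ∀ ω ∈ B m, ⊥ < σ ω := fun m ω hω => bot_le.trans_lt hω.1.2
  have hKc : ∀ m, ∀ ω ∈ B m, ∫⁻ u in Ioc s (θ m ω), ‖K (ω, u)‖ₑ ∂κ ω ≤ ENNReal.ofReal c :=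
    fun m ω hω => (lintegral_mono_set Ioc_subset_Iic_self).trans
      (hσb ω (hpos m ω hω) _ (hθσ m ω)).2
  let f : ℕ → Ω → ℝ := fun m => (B m).indicator fun ω =>
    q ⊤ ω * (M (θ m ω) ω - M s ω - ∫ u in Ioc s (θ m ω), K (ω, u) ∂κ ω)
  have key : ∀ m, Integrable (f m) P ∧ ∫ ω, f m ω ∂P = 0 := by
    intro m
    refine integral_density_mul_increment_eq_zero
      (N := fun u => G.indicator (stoppedProcess (fun i => {ω | ⊥ < ρ m ω}.indicator (N i)) (ρ m) u))
      hq hc h0 (martingale_indicator_of_ae hF (hρM m) hG) ?_ hκ hM hK (hθ m) (hB m) (hsθ m) hc0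
      (fun ω hω => (hσb ω (hpos m ω hω) s hω.1.2.le).1)
      (fun ω hω => (hσb ω (hpos m ω hω) _ (hθσ m ω)).1) (hKc m) ?_
    · intro ω u
      by_cases hω : ω ∈ G
      · simp only [indicator_of_mem hω]
        by_cases hp : ω ∈ {ω | ⊥ < ρ m ω}
        · have h1 : (fun v => stoppedProcess (fun i => {ω | ⊥ < ρ m ω}.indicator (N i)) (ρ m) v ω) =
              (fun v => N v ω) ∘ capTime (ρ m ω) := by
            ext v
            exact indicator_of_mem hp _
          rw [h1]
          exact ContinuousWithinAt.comp (t := Ici (capTime (ρ m ω) u)) (hω _)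
            (continuous_capTime _).continuousWithinAt fun v hv => monotone_capTime _ hv
        · have h1 : (fun v => stoppedProcess (fun i => {ω | ⊥ < ρ m ω}.indicator (N i)) (ρ m) v ω) =
              fun _ => 0 := by
            ext v
            exact indicator_of_notMem hp _
          rw [h1]
          exact continuousWithinAt_const
      · simp only [indicator_of_notMem hω]
        exact continuousWithinAt_const
    · filter_upwards [hG, hNM] with ω hωG hω hωB
      have hρpos : ω ∈ {ω | ⊥ < ρ m ω} := (bot_le.trans_lt hωB.2 : ⊥ < ρ m ω)
      have h1 : ∀ u : Time T, (u : WithTop (Time T)) ≤ ρ m ω →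
          stoppedProcess (fun i => {ω | ⊥ < ρ m ω}.indicator (N i)) (ρ m) u ω = N u ω := by
        intro u hu
        refine (indicator_of_mem hρpos _).trans ?_
        change N (capTime (ρ m ω) u) ω = _
        rw [capTime_of_le hu]
      have hle := hsθ m ω hωB
      have h2 : ∫ u in Iic (θ m ω), K (ω, u) * q u ω ∂κ ω = ∫ u in Iic s, K (ω, u) * q u ω ∂κ ω +
          ∫ u in Ioc s (θ m ω), K (ω, u) * q u ω ∂κ ω := by
        rw [← Iic_union_Ioc_eq_Iic hle, setIntegral_union (Iic_disjoint_Ioc le_rfl)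
          measurableSet_Ioc hω.1.integrableOn hω.1.integrableOn]
      rw [indicator_of_mem hωG, indicator_of_mem hωG,
        h1 _ ((coe_capTime_le _ _).trans (min_le_right _ _)), h1 _ hωB.2.le, hω.2, hω.2, h2]
      ring
  have hlim : ∀ᵐ ω ∂P, Tendsto (fun m => f m ω) atTop (𝓝 (A.indicator (fun ω => q ⊤ ω *
      (stoppedCompensated κ M K σ t ω - stoppedCompensated κ M K σ s ω)) ω)) := by
    filter_upwards [hρ.tendsto_top] with ω hω
    refine tendsto_const_nhds.congr' ?_
    filter_upwards [eventually_eq_top_of_tendsto hω] with m hm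
    by_cases hωA : ω ∈ A
    · rw [indicator_of_mem hωA]
      by_cases hωσ : (s : WithTop (Time T)) < σ ω
      · have hωB : ω ∈ B m := ⟨⟨hωA, hωσ⟩, by
          change _ < ρ m ω
          rw [hm]
          exact WithTop.coe_lt_top s⟩
        have h1 : θ m ω = capTime (σ ω) t := by simp only [θ, hm, min_top_right]
        simp only [f, indicator_of_mem hωB, h1]
        rw [stoppedCompensated_sub_of_lt hσb hK.measurable hst hωσ]
      · have hωB : ω ∉ B m := fun h => hωσ h.1.2
        simp only [f, indicator_of_notMem hωB]
        rw [stoppedCompensated_eq_of_le hst (not_lt.1 hωσ), sub_self, mul_zero]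
    · have hωB : ω ∉ B m := fun h => hωA h.1.1
      simp only [f, indicator_of_notMem hωB, indicator_of_notMem hωA]
  -- One `c` for each of `M_θ`, `M_s` and the integral.
  have hbound : ∀ m, ∀ᵐ ω ∂P, ‖f m ω‖ ≤ ‖q ⊤ ω‖ * (3 * c) := fun m => ae_of_all _ fun ω => by
    by_cases hωB : ω ∈ B m
    · simp only [f, indicator_of_mem hωB]
      rw [norm_mul]
      gcongr
      have h1 := (hσb ω (hpos m ω hωB) s hωB.1.2.le).1
      have h2 := (hσb ω (hpos m ω hωB) _ (hθσ m ω)).1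
      have h3 := abs_setIntegral_le_of_lintegral hc0 (hKc m ω hωB)
      rw [Real.norm_eq_abs]
      have h4 := abs_sub (M (θ m ω) ω - M s ω) (∫ u in Ioc s (θ m ω), K (ω, u) ∂κ ω)
      have h5 := abs_sub (M (θ m ω) ω) (M s ω)
      linarith
    · simp only [f, indicator_of_notMem hωB, norm_zero]
      positivity
  have hdct := tendsto_integral_of_dominated_convergence (fun ω => ‖q ⊤ ω‖ * (3 * c))
    (fun m => (key m).1.aestronglyMeasurable) ((hq.integrable ⊤).norm.mul_const _) hbound hlim
  simp only [(key _).2] at hdct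
  rw [← integral_indicator (F.le _ _ hA)]
  exact (tendsto_nhds_unique hdct tendsto_const_nhds)

end Girsanov

/-! ### First entrance times -/

open scoped Classical in
/-- The infimum of `S`, equal to `⊤` if `S` is empty. -/
def firstTime (S : Set (Time T)) : WithTop (Time T) :=
  if h : S.Nonempty then
    ((⟨sInf (Subtype.val '' S), mem_Iic.2 ((csInf_le (OrderBot.bddBelow _)
      (mem_image_of_mem _ h.some_mem)).trans (mem_Iic.1 h.some.2))⟩ : Time T) : WithTop (Time T))
  else ⊤

lemma firstTime_lt_iff {S : Set (Time T)} {t : Time T} :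
    firstTime S < (t : WithTop (Time T)) ↔ ∃ r ∈ S, r < t := by
  rw [firstTime]
  split_ifs with h
  · rw [WithTop.coe_lt_coe, ← Subtype.coe_lt_coe, csInf_lt_iff (OrderBot.bddBelow _) (h.image _)]
    constructor
    · rintro ⟨_, ⟨r, hr, rfl⟩, hrt⟩
      exact ⟨r, hr, hrt⟩
    · rintro ⟨r, hr, hrt⟩
      exact ⟨r, ⟨r, hr, rfl⟩, hrt⟩
  · simp only [not_top_lt, false_iff, not_exists, not_and]
    exact fun r hr => (h ⟨r, hr⟩).elim

lemma firstTime_empty : firstTime (∅ : Set (Time T)) = ⊤ := by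
  simp [firstTime]

lemma firstTime_le_coe_top_iff {S : Set (Time T)} :
    firstTime S ≤ ((⊤ : Time T) : WithTop (Time T)) ↔ S.Nonempty := by
  rw [firstTime]
  split_ifs with h
  · simp only [h, iff_true]
    exact WithTop.coe_le_coe.2 le_top
  · simp only [h, iff_false, top_le_iff]
    exact WithTop.coe_ne_top

lemma firstTime_le {S : Set (Time T)} {r : Time T} (hr : r ∈ S) :
    firstTime S ≤ (r : WithTop (Time T)) := by
  have h : S.Nonempty := ⟨r, hr⟩
  rw [firstTime, dif_pos h, WithTop.coe_le_coe]
  exact Subtype.coe_le_coe.1 (csInf_le (OrderBot.bddBelow _) (mem_image_of_mem Subtype.val hr) :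
    sInf (Subtype.val '' S) ≤ (r : ℝ≥0))

lemma firstTime_anti {S S' : Set (Time T)} (h : S ⊆ S') : firstTime S' ≤ firstTime S := by
  rcases S.eq_empty_or_nonempty with h0 | hne
  · rw [h0, firstTime_empty]
    exact le_top
  · simp only [firstTime, dif_pos hne, dif_pos (hne.mono h)]
    exact WithTop.coe_le_coe.2 (Subtype.coe_le_coe.1
      (csInf_le_csInf (OrderBot.bddBelow _) (hne.image _) (image_mono h) :
        sInf (Subtype.val '' S') ≤ sInf (Subtype.val '' S)))

/-- A point of `S` before `T` is followed by an interval inside `S`, so `{firstTime < t}` is a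
countable union over a dense set of times. This controls strict inequalities only, hence the
right-continuous filtration. -/
lemma isStoppingTime_firstTime {F : Filtration (Time T) mΩ} {S : Ω → Set (Time T)}
    (hS : ∀ t, MeasurableSet[F t] {ω | t ∈ S ω})
    (hr : ∀ ω, ∀ r ∈ S ω, r < ⊤ → ∀ᶠ v in 𝓝[>] r, v ∈ S ω) :
    IsStoppingTime F.rightCont fun ω => firstTime (S ω) := by
  obtain ⟨D, hD, hDd⟩ := TopologicalSpace.exists_countable_dense (Time T)
  have hden : ∀ ω, ∀ r ∈ S ω, ∀ t, r < t → ∃ v ∈ D, v < t ∧ v ∈ S ω := by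
    intro ω r hrS t hrt
    have h1 := hr ω r hrS (hrt.trans_le le_top)
    rw [eventually_iff, mem_nhdsGT_iff_exists_Ioo_subset' hrt] at h1
    obtain ⟨u, hu, hsub⟩ := h1
    obtain ⟨v, hv, hv1, hv2⟩ := hDd.exists_between (lt_min (mem_Ioi.1 hu) hrt)
    exact ⟨v, hv, hv2.trans_le (min_le_right _ _), hsub ⟨hv1, hv2.trans_le (min_le_left _ _)⟩⟩
  have hlt : ∀ t : Time T, MeasurableSet[F t] {ω | firstTime (S ω) < (t : WithTop (Time T))} := by
    intro t
    have : {ω | firstTime (S ω) < (t : WithTop (Time T))} =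
        ⋃ v ∈ {v ∈ D | v < t}, {ω | v ∈ S ω} := by
      ext ω
      simp only [firstTime_lt_iff, mem_iUnion, mem_ofPred_eq, exists_prop]
      constructor
      · rintro ⟨r, hrS, hrt⟩
        obtain ⟨v, h1, h2, h3⟩ := hden ω r hrS t hrt
        exact ⟨v, ⟨h1, h2⟩, h3⟩
      · rintro ⟨v, ⟨-, h2⟩, h3⟩
        exact ⟨v, h3, h2⟩
    rw [this]
    exact MeasurableSet.biUnion (hD.mono fun _ h => h.1) fun v hv => F.mono hv.2.le _ (hS v)
  intro t
  -- At `T` the right-continuous filtration is `F ⊤` itself, so the possibility that `S` is first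
  -- met at `T` is treated separately.
  rcases eq_or_lt_of_le (le_top (a := t)) with rfl | ht
  · rw [Filtration.rightCont_eq_of_isMax _ isMax_top]
    have : {ω | firstTime (S ω) ≤ ((⊤ : Time T) : WithTop (Time T))} =
        {ω | ⊤ ∈ S ω} ∪ {ω | firstTime (S ω) < ((⊤ : Time T) : WithTop (Time T))} := by
      ext ω
      simp only [firstTime_le_coe_top_iff, mem_union, mem_ofPred_eq, firstTime_lt_iff]
      constructor
      · rintro ⟨r, hrS⟩
        rcases eq_or_lt_of_le (le_top (a := r)) with rfl | h
        · exact Or.inl hrS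
        · exact Or.inr ⟨r, hrS, h⟩
      · rintro (h | ⟨r, h, -⟩)
        · exact ⟨_, h⟩
        · exact ⟨_, h⟩
    rw [this]
    exact (hS ⊤).union (hlt ⊤)
  · rw [Filtration.rightCont_eq_of_not_isMax _ (not_isMax_iff.2 ⟨⊤, ht⟩)]
    simp only [MeasurableSpace.measurableSet_iInf]
    intro j hj
    have : {ω | firstTime (S ω) ≤ (t : WithTop (Time T))} =
        ⋂ v ∈ {v ∈ D | t < v ∧ v < j}, {ω | firstTime (S ω) < (v : WithTop (Time T))} := by
      ext ω
      simp only [mem_iInter, mem_ofPred_eq]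
      constructor
      · intro h v hv
        exact h.trans_lt (WithTop.coe_lt_coe.2 hv.2.1)
      · intro h
        by_contra! hlt'
        have : ∃ w, t < w ∧ w ≤ j ∧ (w : WithTop (Time T)) ≤ firstTime (S ω) := by
          refine ⟨capTime (firstTime (S ω)) j, ?_, capTime_le _ _, coe_capTime_le _ _⟩
          rw [← not_le, capTime_le_iff, not_or]
          exact ⟨not_le.2 hj, not_le.2 hlt'⟩
        obtain ⟨w, hw1, hw2, hw3⟩ := this
        obtain ⟨v, hv, hv1, hv2⟩ := hDd.exists_between hw1
        exact absurd (h v ⟨hv, hv1, hv2.trans_le hw2⟩)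
          (not_lt.2 ((WithTop.coe_le_coe.2 hv2.le).trans hw3))
    rw [this]
    exact MeasurableSet.biInter (hD.mono fun _ h => h.1) fun v hv => F.mono hv.2.2.le _ (hlt v)

/-! ### Exit times -/

/-- The times at which `|M|` or `∫ |K| dκ` exceeds `n`. -/
def exceedSet (κ : Ω → Measure (Time T)) (M : Time T → Ω → ℝ) (K : Ω × Time T → ℝ) (n : ℕ)
    (ω : Ω) : Set (Time T) :=
  {t | (n : ℝ) < |M t ω| ∨ (n : ℝ≥0∞) < ∫⁻ s in Iic t, ‖K (ω, s)‖ₑ ∂κ ω}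

/-- The first time at which `|M|` or `∫ |K| dκ` exceeds `n`. -/
def exitTime (κ : Ω → Measure (Time T)) (M : Time T → Ω → ℝ) (K : Ω × Time T → ℝ) (n : ℕ)
    (ω : Ω) : WithTop (Time T) := firstTime (exceedSet κ M K n ω)

section ExitTime

variable {F : Filtration (Time T) mΩ} {κ : Ω → Measure (Time T)}
  {M : Time T → Ω → ℝ} {K : Ω × Time T → ℝ}

lemma isStoppingTime_exitTime [∀ ω, IsFiniteMeasure (κ ω)] (hκ : IsAdaptedMeasure F κ)
    (hM : StronglyAdapted F M)
    (hMc : ∀ ω, Continuous fun t => M t ω) (hK : IsProgressive F K) (n : ℕ) :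
    IsStoppingTime F.rightCont (exitTime κ M K n) := by
  refine isStoppingTime_firstTime (fun t => ?_) (fun ω r hr hrt => ?_)
  · have h1 := ((hK.comp measurable_enorm).setLIntegral_Iic hκ).measurable_apply t
    have h2 : Measurable[F t] fun ω => |M t ω| := 
      continuous_abs.measurable.comp (hM t).measurable
    exact (h2 measurableSet_Ioi).union (h1 measurableSet_Ioi)
  · rcases hr with hr | hr
    · have h1 : ∀ᶠ v in 𝓝 r, (n : ℝ) < |M v ω| :=
        ((hMc ω).abs.tendsto r).eventually (lt_mem_nhds hr)
      exact (h1.filter_mono nhdsWithin_le_nhds).mono fun v hv => Or.inl hv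
    · filter_upwards [self_mem_nhdsWithin] with v hv
      exact Or.inr (hr.trans_le (lintegral_mono_set (Iic_subset_Iic.2 (mem_Ioi.1 hv).le)))

/-- The bounds hold strictly before the exit time by definition. They extend to the exit time itself
because `M` is continuous and `κ` has no atoms. -/
lemma isBoundingTime_exitTime (hκ0 : ∀ ω t, κ ω {t} = 0) (hMc : ∀ ω, Continuous fun t => M t ω)
    (n : ℕ) : IsBoundingTime κ M K n (exitTime κ M K n) := by
  intro ω hpos u hu
  rw [ENNReal.ofReal_natCast]
  have hlt : ∀ r : Time T, (r : WithTop (Time T)) < exitTime κ M K n ω →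
      |M r ω| ≤ n ∧ ∫⁻ s in Iic r, ‖K (ω, s)‖ₑ ∂κ ω ≤ n := by
    intro r hr
    have h : r ∉ exceedSet κ M K n ω := fun h => absurd (firstTime_le h) (not_le.2 hr)
    exact ⟨not_lt.1 fun h' => h (Or.inl h'), not_lt.1 fun h' => h (Or.inr h')⟩
  -- No time precedes `0`, so there the bound comes from positivity of the exit time.
  rcases eq_or_lt_of_le (bot_le (a := u)) with rfl | hub
  · exact hlt _ (by simpa using hpos)
  have hlt' : ∀ r < u, |M r ω| ≤ n ∧ ∫⁻ s in Iic r, ‖K (ω, s)‖ₑ ∂κ ω ≤ n := fun r hr =>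
    hlt r ((WithTop.coe_lt_coe.2 hr).trans_le hu)
  constructor
  · have : (𝓝[<] u).NeBot := nhdsLT_neBot_of_exists_lt ⟨⊥, hub⟩
    refine le_of_tendsto (((hMc ω).abs.tendsto u).mono_left nhdsWithin_le_nhds :
      Tendsto (fun t => |M t ω|) (𝓝[<] u) _) ?_
    filter_upwards [self_mem_nhdsWithin] with r hr using (hlt' r hr).1
  · let ν := (κ ω).withDensity fun s => ‖K (ω, s)‖ₑ
    have h1 : ∀ r, ν (Iic r) = ∫⁻ s in Iic r, ‖K (ω, s)‖ₑ ∂κ ω := fun r =>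
      withDensity_apply _ measurableSet_Iic
    have h2 : ν {u} = 0 := withDensity_absolutelyContinuous _ _ (hκ0 ω u)
    have hI : Iic u = Iio u ∪ {u} := Iio_union_right.symm
    rw [← h1, hI]
    refine (measure_union_le _ _).trans ?_
    rw [h2, add_zero]
    exact measure_Iio_le_of_forall_Iic fun r hr => (h1 r).trans_le (hlt' r hr).2

lemma monotone_exitTime (ω : Ω) : Monotone fun n => exitTime κ M K n ω := by
  intro m n hmn
  refine firstTime_anti fun t ht => ?_
  rcases ht with ht | ht
  · exact Or.inl (lt_of_le_of_lt (by exact_mod_cast hmn) ht)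
  · exact Or.inr (lt_of_le_of_lt (by exact_mod_cast hmn) ht)

lemma eventually_exitTime_eq_top (hMc : ∀ ω, Continuous fun t => M t ω) {ω : Ω}
    (h : ∫⁻ s, ‖K (ω, s)‖ₑ ∂κ ω < ∞) : ∀ᶠ n in atTop, exitTime κ M K n ω = ⊤ := by
  have : CompactSpace (Time T) := ⟨by rw [← Icc_bot_top]; exact isCompact_Icc⟩
  obtain ⟨c, hc⟩ := (isCompact_range (hMc ω).abs).bddAbove
  obtain ⟨n₁, hn₁⟩ := exists_nat_ge c
  obtain ⟨n₂, hn₂⟩ := ENNReal.exists_nat_gt h.ne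
  filter_upwards [eventually_ge_atTop (max n₁ n₂)] with n hn
  have h1 : (n₁ : ℝ) ≤ n := by exact_mod_cast (le_max_left _ _).trans hn
  have h2 : (n₂ : ℝ≥0∞) ≤ n := by exact_mod_cast (le_max_right _ _).trans hn
  have : exceedSet κ M K n ω = ∅ := by
    refine eq_empty_of_forall_notMem fun t ht => ?_
    rcases ht with ht | ht
    · exact absurd ((hc (mem_range_self t)).trans (hn₁.trans h1)) ht.not_ge
    · exact absurd ((setLIntegral_le_lintegral _ _).trans (hn₂.le.trans h2)) ht.not_ge
  rw [exitTime, this, firstTime_empty]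

lemma measurable_stoppedCompensated [∀ ω, IsFiniteMeasure (κ ω)] (hκ : IsAdaptedMeasure F κ)
    (hM : IsProgressive F fun p => M p.2 p.1) (hK : IsProgressive F K)
    {σ : Ω → WithTop (Time T)} (hσ : IsStoppingTime F σ) (t : Time T) :
    Measurable[F t] (stoppedCompensated κ M K σ t) := by
  have h1 : IsProgressive F fun p : Ω × Time T => M p.2 p.1 - ∫ u in Iic p.2, K (p.1, u) ∂κ p.1 :=
    (hM.prodMk (hK.setIntegral_Iic hκ)).comp (g := fun x => x.1 - x.2) (by fun_prop)
  have h2 := (h1 t).comp (Measurable.prodMk (m := F t) (@measurable_id _ (F t))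
    (measurable_capTime hσ t))
  have h3 : MeasurableSet[F t] {ω | ⊥ < σ ω} := F.mono bot_le _ (hσ.measurableSet_gt ⊥)
  convert h2.indicator h3 using 1
  ext ω
  simp only [stoppedCompensated, Function.comp_apply, id, indicator,
    min_eq_left (capTime_le _ t)]

end ExitTime

/-! ### Disintegration of the joint law of `L` and the reference σ-algebra -/

section Disintegration

variable {Ω' : Type*} {mΩ' : MeasurableSpace Ω'} {P : Measure Ω} [IsProbabilityMeasure P]
  {L : Ω → ℝ} {φ : Ω → Ω'} {g : ℝ × Ω' → ℝ}

/-- It suffices to compare both measures on rectangles. The map `φ` will be the identity from `Ω` to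
`Ω` with the smaller σ-algebra `F ⊤`. -/
lemma map_prodMk_eq_withDensity (hL : Measurable L) (hφ : Measurable φ) (hg : Measurable g)
    (h : ∀ A B, MeasurableSet A → MeasurableSet B → P (L ⁻¹' B ∩ φ ⁻¹' A) =
      ∫⁻ ω in φ ⁻¹' A, ∫⁻ x in B, ENNReal.ofReal (g (x, φ ω)) ∂(P.map L) ∂P) :
    P.map (fun ω => (L ω, φ ω)) =
      ((P.map L).prod (P.map φ)).withDensity fun p => ENNReal.ofReal (g p) := by
  have : IsProbabilityMeasure (P.map L) := Measure.isProbabilityMeasure_map hL.aemeasurable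
  have : IsProbabilityMeasure (P.map φ) := Measure.isProbabilityMeasure_map hφ.aemeasurable
  have : IsProbabilityMeasure (P.map fun ω => (L ω, φ ω)) :=
    Measure.isProbabilityMeasure_map (hL.prodMk hφ).aemeasurable
  refine Measure.ext_prod fun {B A} hB hA => ?_
  have hg' : Measurable fun p => ENNReal.ofReal (g p) := hg.ennreal_ofReal
  rw [Measure.map_apply (hL.prodMk hφ) (hB.prod hA), withDensity_apply _ (hB.prod hA),
    ← Measure.prod_restrict, lintegral_prod_symm _ hg'.aemeasurable,
    setLIntegral_map hA hg'.lintegral_prod_left' hφ, ← h A B hA hB]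
  rfl

/-- Fubini: the expectation at `x = L` is the average over the law of `L` of the density-weighted
expectations at fixed `x`. -/
lemma integral_comp_prodMk_eq_zero (hL : Measurable L) (hφ : Measurable φ) (hg : Measurable g)
    (h0 : ∀ p, 0 ≤ g p)
    (hmap : P.map (fun ω => (L ω, φ ω)) =
      ((P.map L).prod (P.map φ)).withDensity fun p => ENNReal.ofReal (g p))
    {f : ℝ × Ω' → ℝ} (hf : Measurable f) {c : ℝ} (hc : ∀ p, |f p| ≤ c)
    (hfx : ∀ x, ∫ ω, g (x, φ ω) * f (x, φ ω) ∂P = 0) : ∫ ω, f (L ω, φ ω) ∂P = 0 := by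
  have : IsProbabilityMeasure (P.map L) := Measure.isProbabilityMeasure_map hL.aemeasurable
  have : IsProbabilityMeasure (P.map φ) := Measure.isProbabilityMeasure_map hφ.aemeasurable
  have : IsProbabilityMeasure (P.map fun ω => (L ω, φ ω)) :=
    Measure.isProbabilityMeasure_map (hL.prodMk hφ).aemeasurable
  have hg' : Measurable fun p => ENNReal.ofReal (g p) := hg.ennreal_ofReal
  have hint : Integrable f (P.map fun ω => (L ω, φ ω)) :=
    Integrable.of_bound hf.aestronglyMeasurable c (ae_of_all _ hc)
  rw [← integral_map (φ := fun ω => (L ω, φ ω)) (hL.prodMk hφ).aemeasurable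
    hf.aestronglyMeasurable]
  rw [hmap] at hint ⊢
  rw [integrable_withDensity_iff_integrable_smul' hg' (ae_of_all _ fun _ => ENNReal.ofReal_lt_top)]
    at hint
  rw [integral_withDensity_eq_integral_toReal_smul hg' (ae_of_all _ fun _ => ENNReal.ofReal_lt_top),
    integral_prod _ hint]
  refine integral_eq_zero_of_ae (ae_of_all _ fun x => ?_)
  simp only [ENNReal.toReal_ofReal (h0 _), smul_eq_mul, Pi.zero_apply]
  rw [integral_map (f := fun y => g (x, y) * f (x, y)) hφ.aemeasurable, hfx x]
  exact ((hg.mul hf).comp measurable_prodMk_left).aestronglyMeasurable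

/-- The almost sure counterpart of Fubini. Points where the density vanishes are not charged by the
joint law, so nothing is required there. -/
lemma ae_comp_prodMk (hL : Measurable L) (hφ : Measurable φ) (hg : Measurable g)
    (hmap : P.map (fun ω => (L ω, φ ω)) =
      ((P.map L).prod (P.map φ)).withDensity fun p => ENNReal.ofReal (g p))
    {S : Set (ℝ × Ω')} (hS : MeasurableSet S)
    (hSx : ∀ x, ∀ᵐ ω ∂P, 0 < g (x, φ ω) → (x, φ ω) ∈ S) : ∀ᵐ ω ∂P, (L ω, φ ω) ∈ S := by
  have : IsProbabilityMeasure (P.map L) := Measure.isProbabilityMeasure_map hL.aemeasurable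
  have : IsProbabilityMeasure (P.map φ) := Measure.isProbabilityMeasure_map hφ.aemeasurable
  have hg' : Measurable fun p => ENNReal.ofReal (g p) := hg.ennreal_ofReal
  rw [← ae_map_iff (p := fun p => p ∈ S) (hL.prodMk hφ).aemeasurable hS, hmap,
    ae_withDensity_iff hg']
  have hS' : MeasurableSet {p | ENNReal.ofReal (g p) ≠ 0 → p ∈ S} :=
    (((hg' (measurableSet_singleton 0)).compl).imp hS)
  refine (Measure.ae_prod_iff_ae_ae hS').2 (ae_of_all _ fun x => ?_)
  rw [ae_map_iff (p := fun y => ENNReal.ofReal (g (x, y)) ≠ 0 → (x, y) ∈ S) hφ.aemeasurable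
    (measurable_prodMk_left hS')]
  filter_upwards [hSx x] with ω hω h
  exact hω (by simpa using h)

end Disintegration

lemma measure_inter_eq_lintegral_density {Ω : Type*} {m mΩ : MeasurableSpace Ω} {P : Measure Ω}
    [IsProbabilityMeasure P] {L : Ω → ℝ} (hL : Measurable L) (hm : m ≤ mΩ)
    {κ : @Kernel Ω ℝ m inferInstance}
    (hκ : IsRegularCondLaw P L m κ) {g : ℝ → Ω → ℝ}
    (hκg : ∀ᵐ ω ∂P, κ ω = (P.map L).withDensity fun x => ENNReal.ofReal (g x ω))
    {A : Set Ω} (hA : MeasurableSet[m] A) {B : Set ℝ} (hB : MeasurableSet B) :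
    P (L ⁻¹' B ∩ A) = ∫⁻ ω in A, ∫⁻ x in B, ENNReal.ofReal (g x ω) ∂(P.map L) ∂P := by
  have := hκ.isMarkovKernel
  have hB' : MeasurableSet (L ⁻¹' B) := hL hB
  have hi : Integrable ((L ⁻¹' B).indicator fun _ => (1 : ℝ)) P :=
    (integrable_const _).indicator hB'
  have h1 : ∫ ω in A, (κ ω).real B ∂P = P.real (L ⁻¹' B ∩ A) := by
    rw [setIntegral_congr_ae (g := P[(L ⁻¹' B).indicator fun _ => (1 : ℝ) | m]) (hm _ hA)
      ((hκ.condExp_eq B hB).mono fun ω h _ => h), setIntegral_condExp hm hi hA,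
      integral_indicator_const _ hB', smul_eq_mul, mul_one, measureReal_restrict_apply hB']
  have h2 : ∫⁻ ω in A, κ ω B ∂P = ∫⁻ ω in A, ∫⁻ x in B, ENNReal.ofReal (g x ω) ∂(P.map L) ∂P := by
    refine lintegral_congr_ae (ae_restrict_of_ae ?_)
    filter_upwards [hκg] with ω hω
    rw [hω, withDensity_apply _ hB]
  have hκm : Measurable fun ω => (κ ω).real B :=
    ((Kernel.measurable_coe κ hB).mono hm le_rfl).ennreal_toReal
  rw [← h2, ← ofReal_measureReal, ← h1, ofReal_integral_eq_lintegral_ofReal]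
  · exact lintegral_congr fun ω => ofReal_measureReal
  · refine Integrable.of_bound hκm.aestronglyMeasurable 1 (ae_of_all _ fun ω => ?_)
    rw [Real.norm_of_nonneg measureReal_nonneg]
    exact measureReal_le_one
  · exact ae_of_all _ fun ω => measureReal_nonneg

/-! ### Continuity of indefinite integrals -/

lemma continuous_setIntegral_Iic {μ : Measure (Time T)} (hμ : ∀ t, μ {t} = 0) {f : Time T → ℝ}
    (hf : Integrable f μ) : Continuous fun t => ∫ u in Iic t, f u ∂μ := by
  simp_rw [← integral_indicator (measurableSet_Iic : MeasurableSet (Iic (_ : Time T)))]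
  refine continuous_iff_continuousAt.2 fun t => ?_
  refine continuousAt_of_dominated (bound := fun u => ‖f u‖)
    (Eventually.of_forall fun v => (hf.indicator measurableSet_Iic).aestronglyMeasurable)
    (Eventually.of_forall fun v => ae_of_all _ fun u => norm_indicator_le_norm_self _ _) hf.norm ?_
  have hne : ∀ᵐ u ∂μ, u ≠ t := by
    rw [ae_iff]
    simpa using hμ t
  filter_upwards [hne] with u hu
  rcases lt_or_gt_of_ne hu with h | h
  · refine ContinuousAt.congr (continuousAt_const (y := f u)) ?_
    filter_upwards [lt_mem_nhds h] with v hv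
    exact (indicator_of_mem (mem_Iic.2 hv.le) f).symm
  · refine ContinuousAt.congr (continuousAt_const (y := (0 : ℝ))) ?_
    filter_upwards [gt_mem_nhds h] with v hv
    exact (indicator_of_notMem (fun h' => absurd (mem_Iic.1 h') (not_le.2 hv)) f).symm

/-- Each increment is dominated by that of the monotone function `t ↦ ∫ |f|` over `Iic t`. -/
lemma boundedVariationOn_setIntegral_Iic {μ : Measure (Time T)} {f : Time T → ℝ}
    (hf : Integrable f μ) : BoundedVariationOn (fun t => ∫ u in Iic t, f u ∂μ) univ := by
  have hV : Monotone fun t => ∫ u in Iic t, ‖f u‖ ∂μ := fun s t hst =>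
    setIntegral_mono_set hf.norm.integrableOn (ae_of_all _ fun _ => norm_nonneg _)
      (Iic_subset_Iic.2 hst).eventuallyLE
  have hle : ∀ s t, s ≤ t → edist (∫ u in Iic t, f u ∂μ) (∫ u in Iic s, f u ∂μ) ≤
      edist (∫ u in Iic t, ‖f u‖ ∂μ) (∫ u in Iic s, ‖f u‖ ∂μ) := by
    intro s t hst
    have hsplit : ∀ g : Time T → ℝ, Integrable g μ →
        ∫ u in Iic t, g u ∂μ - ∫ u in Iic s, g u ∂μ = ∫ u in Ioc s t, g u ∂μ := by
      intro g hg
      rw [← Iic_union_Ioc_eq_Iic hst, setIntegral_union (Iic_disjoint_Ioc le_rfl) measurableSet_Ioc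
        hg.integrableOn hg.integrableOn]
      ring
    rw [edist_dist, edist_dist, dist_eq_norm, dist_eq_norm, hsplit f hf, hsplit _ hf.norm]
    exact ENNReal.ofReal_le_ofReal ((norm_integral_le_integral_norm _).trans (le_abs_self _))
  refine ne_top_of_le_ne_top ?_ (iSup_le fun p => (Finset.sum_le_sum fun i _ =>
    hle _ _ (p.2.2.1 i.le_succ)).trans (eVariationOn.sum_le
      (f := fun t => ∫ u in Iic t, ‖f u‖ ∂μ) p.2.2.1 fun i => p.2.2.2 i))
  rw [← univ_inter univ, ← Icc_bot_top,
    (hV.monotoneOn _).eVariationOn_eq (by simp) (by simp)]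
  exact ENNReal.ofReal_ne_top

lemma continuous_stoppedCompensated {κ : Ω → Measure (Time T)} {M : Time T → Ω → ℝ}
    {K : Ω × Time T → ℝ} {c : ℝ} {σ : Ω → WithTop (Time T)} (hκ0 : ∀ ω t, κ ω {t} = 0)
    (hMc : ∀ ω, Continuous fun t => M t ω) (hK : Measurable K) (hσ : IsBoundingTime κ M K c σ)
    (ω : Ω) : Continuous fun t => stoppedCompensated κ M K σ t ω := by
  by_cases h : ⊥ < σ ω
  · have hi := (hσ.integrableOn hK h (coe_capTime_le (σ ω) ⊤)).integrable_indicator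
      measurableSet_Iic
    have h1 := (hMc ω).comp (continuous_capTime (σ ω))
    have h2 := (continuous_setIntegral_Iic (hκ0 ω) hi).comp (continuous_capTime (σ ω))
    refine (h1.sub h2).congr fun t => ?_
    rw [stoppedCompensated, indicator_of_mem (show ω ∈ {ω | ⊥ < σ ω} from h)]
    refine congrArg (M (capTime (σ ω) t) ω - ·) ?_
    simp only [Function.comp_apply]
    rw [setIntegral_indicator measurableSet_Iic, inter_eq_left.2]
    exact Iic_subset_Iic.2 (monotone_capTime _ le_top)
  · simp only [stoppedCompensated, indicator_of_notMem (show ω ∉ {ω | ⊥ < σ ω} from h)]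
    exact continuous_const

/-! ### Processes depending on a parameter -/

/-- The filtration `B(ℝ) ⊗ F t` on `ℝ × Ω`. -/
def parametrized (F : Filtration (Time T) mΩ) :
    Filtration (Time T) (inferInstance : MeasurableSpace (ℝ × Ω)) where
  seq t := MeasurableSpace.prod inferInstance (F t)
  mono' _ _ h := measurableSpace_prod_mono le_rfl (F.mono h)
  le' t := measurableSpace_prod_mono le_rfl (F.le t)

lemma rightCont_top (F : Filtration (Time T) mΩ) : F.rightCont ⊤ = F ⊤ :=
  Filtration.rightCont_eq_of_isMax _ isMax_top

/-- Substituting `L` for the parameter turns objects adapted to the right-continuous version of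
`B(ℝ) ⊗ F t` into `G`-adapted ones. -/
lemma measurable_prodMk_enlargement (F : Filtration (Time T) mΩ) {L : Ω → ℝ} (hL : Measurable L)
    (t : Time T) : Measurable[enlargement F L hL t, (parametrized F).rightCont t]
      fun ω => (L ω, ω) := by
  have h : ∀ s, Measurable[F s ⊔ MeasurableSpace.comap L inferInstance, parametrized F s]
      fun ω => (L ω, ω) := fun s =>
    @Measurable.prodMk _ (F s ⊔ MeasurableSpace.comap L inferInstance) _ _ _ (F s) _ _
      ((comap_measurable L).mono le_sup_right le_rfl) (measurable_id'' le_sup_left)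
  rcases eq_or_lt_of_le (le_top (a := t)) with rfl | ht
  · rw [enlargement_top, rightCont_top]
    exact h ⊤
  · intro S hS
    rw [Filtration.rightCont_eq_of_not_isMax _ (not_isMax_iff.2 ⟨⊤, ht⟩)] at hS
    rw [enlargement_apply _ _ _ _ ht]
    simp only [MeasurableSpace.measurableSet_iInf] at hS ⊢
    exact fun s hs => h s (hS s hs)

/-- The σ-algebra `F s ∨ σ(L)` is the pullback of `B(ℝ) ⊗ F s` along `ω ↦ (L ω, ω)`, so its events
can be sliced at fixed `x`. -/
lemma exists_parametrized_of_measurableSet {F : Filtration (Time T) mΩ} {L : Ω → ℝ} {s : Time T}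
    {A : Set Ω} (hA : MeasurableSet[F s ⊔ MeasurableSpace.comap L inferInstance] A) :
    ∃ S : Set (ℝ × Ω), MeasurableSet[parametrized F s] S ∧ (fun ω => (L ω, ω)) ⁻¹' S = A := by
  have h : F s ⊔ MeasurableSpace.comap L inferInstance =
      MeasurableSpace.comap (fun ω => (L ω, ω)) (parametrized F s) := by
    have := MeasurableSpace.comap_prodMk (mβ := (inferInstance : MeasurableSpace ℝ)) (mγ := F s)
      L (id : Ω → Ω)
    rw [sup_comm]
    refine Eq.trans ?_ this.symm
    rw [MeasurableSpace.comap_id]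
  rw [h] at hA
  exact hA

lemma IsAdaptedMeasure.of_le {F F' : Filtration (Time T) mΩ} (h : F ≤ F')
    {κ : Ω → Measure (Time T)} (hκ : IsAdaptedMeasure F κ) : IsAdaptedMeasure F' κ := fun t =>
  (hκ t).mono (h t) le_rfl

section Parametrized

variable {F : Filtration (Time T) mΩ}

lemma measurable_snd_parametrized (t : Time T) :
    Measurable[parametrized F t, F t] (Prod.snd : ℝ × Ω → Ω) :=
  @measurable_snd _ _ _ (F t)

lemma measurable_prodMk_left_parametrized (x : ℝ) (t : Time T) :
    Measurable[F t, parametrized F t] (Prod.mk x : Ω → ℝ × Ω) :=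
  @measurable_prodMk_left _ _ _ (F t) x

lemma IsAdaptedMeasure.comp_snd {κ : Ω → Measure (Time T)} (hκ : IsAdaptedMeasure F κ) :
    IsAdaptedMeasure (parametrized F) fun p => κ p.2 := fun t =>
  (hκ t).comp (measurable_snd_parametrized t)

lemma stronglyAdapted_parametrized {M : Time T → Ω → ℝ} (hM : StronglyAdapted F M) :
    StronglyAdapted (parametrized F) fun t p => M t p.2 := fun t =>
  (hM t).comp_measurable (measurable_snd_parametrized t)

lemma IsJointlyProgressive.isProgressive {k : ℝ → Time T → Ω → ℝ} (hk : IsJointlyProgressive F k) :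
    IsProgressive (parametrized F) fun p => k p.1.1 p.2 p.1.2 := by
  intro t
  let m : MeasurableSpace ((ℝ × Ω) × Time T) := (parametrized F t).prod inferInstance
  have h1 : Measurable[m] fun p : (ℝ × Ω) × Time T =>
      (⟨min p.2 t, mem_Iic.2 (min_le_right _ _)⟩ : Iic t) :=
    Measurable.subtype_mk
      ((measurable_id.min measurable_const).comp (@measurable_snd _ _ (parametrized F t) _))
  have h2 : Measurable[m, F t] fun p : (ℝ × Ω) × Time T => p.1.2 :=
    (measurable_snd_parametrized t).comp (@measurable_fst _ _ (parametrized F t) _)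
  have h3 : Measurable[m] fun p : (ℝ × Ω) × Time T => p.1.1 :=
    (@measurable_fst _ _ _ (F t)).comp (@measurable_fst _ _ (parametrized F t) _)
  exact (hk t).comp (@Measurable.prodMk _ m _ _ (MeasurableSpace.prod inferInstance (F t)) _ _ _
    (@Measurable.prodMk _ m _ _ _ (F t) _ _ h1 h2) h3)

lemma IsProgressive.of_parametrized {β : Type*} [MeasurableSpace β]
    {f : (ℝ × Ω) × Time T → β} (hf : IsProgressive (parametrized F) f) (x : ℝ) :
    IsProgressive F fun p => f ((x, p.1), p.2) := fun t => by
  have h : Measurable[(F t).prod inferInstance, (parametrized F t).prod inferInstance]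
      fun p : Ω × Time T => ((x, p.1), p.2) :=
    @Measurable.prodMk _ ((F t).prod inferInstance) _ _ (parametrized F t) _ _ _
      ((measurable_prodMk_left_parametrized x t).comp (@measurable_fst _ _ (F t) _))
      (@measurable_snd _ _ (F t) _)
  exact (hf t).comp h

end Parametrized

/-! ### Substituting `L` for the parameter -/

section Substitution

variable {F : Filtration (Time T) mΩ} {P : Measure Ω} [IsProbabilityMeasure P] {L : Ω → ℝ}
  {Q : ∀ t : Time T, @Kernel Ω ℝ (F t) inferInstance} {q : ℝ → Time T → Ω → ℝ}

lemma map_prodMk_eq_withDensity_density (hL : Measurable L)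
    (hQ : IsRegularCondLaw P L (F ⊤) (Q ⊤)) (hq : IsConditionalDensity P F L Q q) :
    @Measure.map _ _ mΩ (parametrized F ⊤) (fun ω => (L ω, ω)) P =
      @Measure.withDensity _ (parametrized F ⊤)
        (@Measure.prod _ _ _ (F ⊤) (P.map L) (@Measure.map _ _ mΩ (F ⊤) id P))
        fun p => ENNReal.ofReal (q p.1 ⊤ p.2) :=
  @map_prodMk_eq_withDensity Ω mΩ Ω (F ⊤) P _ L id _ hL (measurable_id'' (F.le ⊤))
    (hq.measurable ⊤) fun _ _ hA hB =>
      measure_inter_eq_lintegral_density hL (F.le ⊤) hQ (hq.density ⊤) hA hB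

lemma integral_comp_eq_zero_of_density (hL : Measurable L)
    (hQ : IsRegularCondLaw P L (F ⊤) (Q ⊤)) (hq : IsConditionalDensity P F L Q q)
    {f : ℝ × Ω → ℝ} (hf : Measurable[parametrized F ⊤] f) {c : ℝ} (hc : ∀ p, |f p| ≤ c)
    (hfx : ∀ x, ∫ ω, q x ⊤ ω * f (x, ω) ∂P = 0) : ∫ ω, f (L ω, ω) ∂P = 0 :=
  @integral_comp_prodMk_eq_zero Ω mΩ Ω (F ⊤) P _ L id _ hL (measurable_id'' (F.le ⊤))
    (hq.measurable ⊤) (fun _ => hq.nonneg _ _ _) (map_prodMk_eq_withDensity_density hL hQ hq)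
    f hf c hc hfx

lemma ae_comp_of_density (hL : Measurable L)
    (hQ : IsRegularCondLaw P L (F ⊤) (Q ⊤)) (hq : IsConditionalDensity P F L Q q)
    {S : Set (ℝ × Ω)} (hS : MeasurableSet[parametrized F ⊤] S)
    (hSx : ∀ x, ∀ᵐ ω ∂P, 0 < q x ⊤ ω → (x, ω) ∈ S) : ∀ᵐ ω ∂P, (L ω, ω) ∈ S :=
  @ae_comp_prodMk Ω mΩ Ω (F ⊤) P _ L id _ hL (measurable_id'' (F.le ⊤))
    (hq.measurable ⊤) (map_prodMk_eq_withDensity_density hL hQ hq) S hS hSx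

end Substitution

/-! ### The enlarged filtration -/

section Enlarged

variable {F : Filtration (Time T) mΩ} {P : Measure Ω} [IsProbabilityMeasure P] {L : Ω → ℝ}
  {Q : ∀ t : Time T, @Kernel Ω ℝ (F t) inferInstance} {q : ℝ → Time T → Ω → ℝ}
  {κ : Ω → Measure (Time T)} {M : Time T → Ω → ℝ}
  {k : ℝ → Time T → Ω → ℝ}

/-- `1_{τ > 0} (M - ∫ k^x dκ)^τ`, where `τ` is the first time at which `|M|` or `∫ |k^x| dκ`
exceeds `n`, as a process on `ℝ × Ω`. -/
def stoppedFamily (κ : Ω → Measure (Time T)) (M : Time T → Ω → ℝ) (k : ℝ → Time T → Ω → ℝ) (n : ℕ) :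
    Time T → ℝ × Ω → ℝ :=
  stoppedCompensated (fun p => κ p.2) (fun t p => M t p.2) (fun p => k p.1.1 p.2 p.1.2)
    (exitTime (fun p => κ p.2) (fun t p => M t p.2) (fun p => k p.1.1 p.2 p.1.2) n)

lemma isBoundingTime_exitTime_family (hκ0 : ∀ ω t, κ ω {t} = 0)
    (hMc : ∀ ω, Continuous fun t => M t ω) (n : ℕ) :
    IsBoundingTime (fun p : ℝ × Ω => κ p.2) (fun t p => M t p.2) (fun p => k p.1.1 p.2 p.1.2) n
      (exitTime (fun p => κ p.2) (fun t p => M t p.2) (fun p => k p.1.1 p.2 p.1.2) n) :=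
  isBoundingTime_exitTime (fun p : ℝ × Ω => hκ0 p.2) (fun p : ℝ × Ω => hMc p.2) n

lemma abs_stoppedFamily_le (hκ0 : ∀ ω t, κ ω {t} = 0)
    (hMc : ∀ ω, Continuous fun t => M t ω) (n : ℕ) (t : Time T) (p : ℝ × Ω) :
    |stoppedFamily κ M k n t p| ≤ 2 * n :=
  (isBoundingTime_exitTime_family hκ0 hMc n).abs_stoppedCompensated_le (Nat.cast_nonneg n) t p

variable [∀ ω, IsFiniteMeasure (κ ω)]

/-- For fixed `x`, finiteness of `∫ |k^x| dκ` is known only where `q^x_T > 0`; this is all that is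
needed to substitute `L`. -/
lemma ae_lintegral_comp_lt_top (hL : Measurable L)
    (hQ : IsRegularCondLaw P L (F ⊤) (Q ⊤)) (hq : IsConditionalDensity P F L Q q)
    (hκ : IsAdaptedMeasure F κ) (hk : IsJointlyProgressive F k)
    (hint : ∀ x, ∀ᵐ ω ∂P, Integrable (fun u => k x u ω * q x u ω) (κ ω)) :
    ∀ᵐ ω ∂P, ∫⁻ u, ‖k (L ω) u ω‖ₑ ∂κ ω < ∞ := by
  let κ' : Kernel Ω (Time T) := ⟨κ, hκ.measurable⟩
  have : ∀ ω, IsFiniteMeasure (κ' ω) := fun ω => inferInstanceAs (IsFiniteMeasure (κ ω))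
  have := isSFiniteKernel_of_isFiniteMeasure κ'
  have hK := hk.isProgressive.comp measurable_enorm
  have hS : MeasurableSet[parametrized F ⊤]
      {p : ℝ × Ω | ∫⁻ u in Iic ⊤, ‖k p.1 u p.2‖ₑ ∂κ p.2 < ∞} :=
    (hK.setLIntegral_Iic hκ.comp_snd).measurable_apply ⊤ measurableSet_Iio
  have h := ae_comp_of_density hL hQ hq hS fun x => by
    have h1 := lintegral_lt_top_of_martingale_pos (κ := κ') (hq.martingale x)
      (fun ω u => (hq.cadlag x ω u).1) (hq.nonneg x) hκ (hK.of_parametrized x) (by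
        filter_upwards [hint x] with ω hω
        refine lt_of_eq_of_lt (lintegral_congr fun u => ?_) hω.2
        rw [enorm_mul, ← Real.enorm_of_nonneg (hq.nonneg x u ω)])
    filter_upwards [h1] with ω hω hpos
    exact (setLIntegral_le_lintegral _ _).trans_lt (hω hpos)
  filter_upwards [h] with ω hω
  simpa using hω

/-- The first time at which `|M|` or `∫ |k^L| dκ` exceeds `n` is a stopping time. -/
lemma isStoppingTime_exitTime_enlargement (hL : Measurable L) (hκ : IsAdaptedMeasure F κ)
    (hM : StronglyAdapted F M) (hMc : ∀ ω, Continuous fun t => M t ω)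
    (hk : IsJointlyProgressive F k) (n : ℕ) :
    IsStoppingTime (enlargement F L hL) (exitTime κ M (fun p => k (L p.1) p.2 p.1) n) := fun t =>
  measurable_prodMk_enlargement F hL t
    (isStoppingTime_exitTime hκ.comp_snd (stronglyAdapted_parametrized hM) (fun p => hMc p.2)
      hk.isProgressive n t)

lemma measurable_stoppedFamily (hκ : IsAdaptedMeasure F κ)
    (hM : StronglyAdapted F M) (hMc : ∀ ω, Continuous fun t => M t ω)
    (hk : IsJointlyProgressive F k) (n : ℕ) (t : Time T) :
    Measurable[(parametrized F).rightCont t] (stoppedFamily κ M k n t) := by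
  have hle := (parametrized F).le_rightCont
  refine measurable_stoppedCompensated (hκ.comp_snd.of_le hle) ?_ (hk.isProgressive.of_le hle)
    (isStoppingTime_exitTime hκ.comp_snd (stronglyAdapted_parametrized hM) (fun p => hMc p.2)
      hk.isProgressive n) t
  exact (isProgressive_of_rightContinuous (stronglyAdapted_parametrized hM)
    fun p u => (hMc p.2).continuousWithinAt).of_le hle

/-- By disintegration it is enough to treat each slice of the event at fixed `x` with weight
`q^x_T`, which is the Girsanov identity at the exit time for `k^x`. -/
lemma setIntegral_stoppedFamily_eq (hF : UsualConditions F P) (hL : Measurable L)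
    (hQ : IsRegularCondLaw P L (F ⊤) (Q ⊤)) (hq : IsConditionalDensity P F L Q q)
    (hκ0 : ∀ ω t, κ ω {t} = 0) (hκ : IsAdaptedMeasure F κ)
    (hM : StronglyAdapted F M) (hMc : ∀ ω, Continuous fun t => M t ω)
    (hk : IsJointlyProgressive F k)
    (hN : ∀ x, ∃ N, IsLocalMartingale F P N ∧ ∀ᵐ ω ∂P,
      Integrable (fun u => k x u ω * q x u ω) (κ ω) ∧
      ∀ t, N t ω = q x t ω * M t ω - ∫ u in Iic t, k x u ω * q x u ω ∂κ ω)
    (n : ℕ) {s t : Time T} (hst : s ≤ t) {A : Set Ω}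
    (hA : MeasurableSet[F s ⊔ MeasurableSpace.comap L inferInstance] A) :
    ∫ ω in A, (stoppedFamily κ M k n t (L ω, ω) - stoppedFamily κ M k n s (L ω, ω)) ∂P = 0 := by
  obtain ⟨S, hS, rfl⟩ := exists_parametrized_of_measurableSet hA
  have hA' : MeasurableSet ((fun ω => (L ω, ω)) ⁻¹' S) :=
    (hL.prodMk measurable_id) ((parametrized F).le s _ hS)
  let κ' : Kernel Ω (Time T) := ⟨κ, hκ.measurable⟩
  have : ∀ ω, IsFiniteMeasure (κ' ω) := fun ω => inferInstanceAs (IsFiniteMeasure (κ ω))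
  have := isSFiniteKernel_of_isFiniteMeasure κ'
  let f : ℝ × Ω → ℝ := S.indicator fun p => stoppedFamily κ M k n t p - stoppedFamily κ M k n s p
  have hmeas : ∀ r, Measurable[parametrized F ⊤] (stoppedFamily κ M k n r) := fun r => by
    have h := (measurable_stoppedFamily hκ hM hMc hk n r).mono
      ((parametrized F).rightCont.mono le_top) le_rfl
    rwa [rightCont_top] at h
  have hf : Measurable[parametrized F ⊤] f :=
    ((hmeas t).sub (hmeas s)).indicator ((parametrized F).mono le_top _ hS)
  rw [← integral_indicator hA']
  refine integral_comp_eq_zero_of_density (f := f) (c := 4 * n) hL hQ hq hf (fun p => ?_) fun x => ?_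
  · have h0 := norm_indicator_le_norm_self (s := S)
      (fun p => stoppedFamily κ M k n t p - stoppedFamily κ M k n s p) p
    refine h0.trans ?_
    rw [Real.norm_eq_abs]
    refine (abs_sub (stoppedFamily κ M k n t p) (stoppedFamily κ M k n s p)).trans ?_
    have h1 := abs_stoppedFamily_le (k := k) hκ0 hMc n t p
    have h2 := abs_stoppedFamily_le (k := k) hκ0 hMc n s p
    linarith
  · obtain ⟨N, hN1, hN2⟩ := hN x
    have hSx : MeasurableSet[F s] {ω | (x, ω) ∈ S} := measurable_prodMk_left_parametrized x s hS
    have hKx := hk.isProgressive.of_parametrized x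
    -- Exit times are stopping times for the right-continuous filtration; by the usual conditions
    -- this is `F` itself.
    have hRC : F.rightCont = F := le_antisymm hF.rightContinuous.RC F.le_rightCont
    have hσ := isStoppingTime_exitTime hκ hM hMc hKx n
    rw [hRC] at hσ
    have h := setIntegral_density_mul_stoppedCompensated (κ := κ') hF (hq.martingale x)
      (fun ω u => (hq.cadlag x ω u).1) (hq.nonneg x) hκ
      (isProgressive_of_rightContinuous hM fun ω u => (hMc ω).continuousWithinAt) hKx hσ
      (Nat.cast_nonneg n) (isBoundingTime_exitTime hκ0 hMc n) hN1 hN2 hst hSx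
    rw [← integral_indicator (F.le s _ hSx)] at h
    refine Eq.trans (integral_congr_ae (ae_of_all _ fun ω => ?_)) h
    by_cases hω : (x, ω) ∈ S
    · simp only [f]
      rw [indicator_of_mem hω, indicator_of_mem (show ω ∈ {ω | (x, ω) ∈ S} from hω)]
      rfl
    · simp only [f]
      rw [indicator_of_notMem hω, indicator_of_notMem (show ω ∉ {ω | (x, ω) ∈ S} from hω), mul_zero]

/-- An event of `G_s` belongs to `F_r ∨ σ(L)` for every `r > s`, so increments from `r` to `t`
integrate to zero over it. Letting `r` decrease to `s` is legitimate because the stopped process is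
bounded and continuous. -/
theorem martingale_stoppedFamily (hF : UsualConditions F P) (hL : Measurable L)
    (hQ : IsRegularCondLaw P L (F ⊤) (Q ⊤)) (hq : IsConditionalDensity P F L Q q)
    (hκ0 : ∀ ω t, κ ω {t} = 0) (hκ : IsAdaptedMeasure F κ)
    (hM : StronglyAdapted F M) (hMc : ∀ ω, Continuous fun t => M t ω)
    (hk : IsJointlyProgressive F k)
    (hN : ∀ x, ∃ N, IsLocalMartingale F P N ∧ ∀ᵐ ω ∂P,
      Integrable (fun u => k x u ω * q x u ω) (κ ω) ∧
      ∀ t, N t ω = q x t ω * M t ω - ∫ u in Iic t, k x u ω * q x u ω ∂κ ω)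
    (n : ℕ) :
    Martingale (fun t ω => stoppedFamily κ M k n t (L ω, ω)) (enlargement F L hL) P := by
  let Y : Time T → Ω → ℝ := fun t ω => stoppedFamily κ M k n t (L ω, ω)
  have hYm : ∀ t, Measurable[enlargement F L hL t] (Y t) := fun t =>
    (measurable_stoppedFamily hκ hM hMc hk n t).comp (measurable_prodMk_enlargement F hL t)
  have hYb : ∀ t ω, ‖Y t ω‖ ≤ 2 * n := fun t ω => abs_stoppedFamily_le hκ0 hMc n t _
  have hYi : ∀ t, Integrable (Y t) P := fun t =>
    Integrable.of_bound ((hYm t).mono ((enlargement F L hL).le t) le_rfl).aestronglyMeasurable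
      _ (ae_of_all _ (hYb t))
  have hYc : ∀ ω, Continuous fun t => Y t ω := fun ω =>
    continuous_stoppedCompensated (fun p : ℝ × Ω => hκ0 p.2) (fun p : ℝ × Ω => hMc p.2)
      hk.isProgressive.measurable
      (isBoundingTime_exitTime_family hκ0 hMc n) (L ω, ω)
  refine ⟨fun t => (hYm t).stronglyMeasurable, fun s t hst => ?_⟩
  refine (ae_eq_condExp_of_forall_setIntegral_eq ((enlargement F L hL).le s) (hYi t)
    (fun A _ _ => (hYi s).integrableOn) (fun A hA _ => ?_)
    (hYm s).stronglyMeasurable.aestronglyMeasurable).symm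
  rcases eq_or_lt_of_le hst with rfl | hlt
  · rfl
  have hs : s < ⊤ := hlt.trans_le le_top
  obtain ⟨r, -, hr1, hr2⟩ := exists_seq_strictAnti_tendsto' hlt
  have hr : ∀ j, ∫ ω in A, Y (r j) ω ∂P = ∫ ω in A, Y t ω ∂P := fun j => by
    rw [enlargement_apply F L hL s hs] at hA
    simp only [MeasurableSpace.measurableSet_iInf] at hA
    have h := setIntegral_stoppedFamily_eq hF hL hQ hq hκ0 hκ hM hMc hk hN n (hr1 j).2.le
      (hA (r j) (hr1 j).1)
    rw [integral_sub (hYi t).integrableOn (hYi (r j)).integrableOn, sub_eq_zero] at h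
    exact h.symm
  have hlim : Tendsto (fun j => ∫ ω in A, Y (r j) ω ∂P) atTop (𝓝 (∫ ω in A, Y s ω ∂P)) :=
    tendsto_integral_of_dominated_convergence (fun _ => 2 * n)
    (fun j => (hYi (r j)).integrableOn.aestronglyMeasurable) (integrable_const _)
    (fun j => ae_of_all _ (hYb (r j)))
    (ae_of_all _ fun ω => ((hYc ω).tendsto s).comp hr2)
  exact tendsto_nhds_unique hlim (tendsto_const_nhds.congr fun j => (hr j).symm)

end Enlarged

/-! ### The enlarged filtration contains the null sets -/

lemma measurable_of_ae_eq_of_complete {Ω : Type*} {m mΩ : MeasurableSpace Ω} {P : Measure Ω}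
    (hm : ∀ S, P S = 0 → MeasurableSet[m] S) {f g : Ω → ℝ} (hf : Measurable[m] f)
    (h : f =ᵐ[P] g) : Measurable[m] g := by
  intro B hB
  have hE : MeasurableSet[m] {ω | f ω = g ω}ᶜ := hm _ h
  have h1 : g ⁻¹' B = (f ⁻¹' B ∩ {ω | f ω = g ω}) ∪ (g ⁻¹' B ∩ {ω | f ω = g ω}ᶜ) := by
    ext ω
    by_cases hω : f ω = g ω <;> simp [hω]
  rw [h1]
  exact ((hf hB).inter (MeasurableSet.of_compl hE)).union
    (hm _ (measure_mono_null inter_subset_right h))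

lemma le_enlargement (F : Filtration (Time T) mΩ) {L : Ω → ℝ} (hL : Measurable L) :
    F ≤ enlargement F L hL :=
  le_sup_left.trans (Filtration.le_rightCont _)

lemma UsualConditions.measurableSet_enlargement {F : Filtration (Time T) mΩ} {P : Measure Ω}
    (hF : UsualConditions F P) {L : Ω → ℝ} (hL : Measurable L) (t : Time T) {S : Set Ω}
    (hS : P S = 0) : MeasurableSet[enlargement F L hL t] S :=
  le_enlargement F hL t _ (F.mono bot_le _ (hF.complete S hS))

lemma martingale_of_ae_eq {F : Filtration (Time T) mΩ} {P : Measure Ω}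
    (hF : ∀ t S, P S = 0 → MeasurableSet[F t] S) {X Y : Time T → Ω → ℝ} (hX : Martingale X F P)
    (h : ∀ t, X t =ᵐ[P] Y t) : Martingale Y F P :=
  ⟨fun t => (measurable_of_ae_eq_of_complete (hF t) (hX.1 t).measurable (h t)).stronglyMeasurable,
    fun s t hst => (condExp_congr_ae (h t).symm).trans ((hX.2 s t hst).trans (h s))⟩

lemma isCadlag_of_continuous {f : Time T → ℝ} (hf : Continuous f) : IsCadlag f := fun t =>
  ⟨hf.continuousWithinAt, f t, hf.continuousWithinAt⟩

lemma setIntegral_Ioc_bot_eq {μ : Measure (Time T)} (hμ : μ {⊥} = 0) (f : Time T → ℝ)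
    (t : Time T) : ∫ u in Ioc ⊥ t, f u ∂μ = ∫ u in Iic t, f u ∂μ := by
  have h : Iic t = Icc ⊥ t := Icc_bot.symm
  rw [h]
  exact (setIntegral_congr_set (Ioc_ae_eq_Icc' hμ))

end InitialEnlargement

end

/-! ### Removal of exceptional paths and assembly of the decomposition. -/

open InitialEnlargement in
theorem mainTheorem2 {Ω : Type*} {mΩ : MeasurableSpace Ω}
    (P : Measure Ω) [IsProbabilityMeasure P]
    (T : ℝ≥0) (hT : 0 < T)
    (F : Filtration (InitialEnlargement.Time T) mΩ)
    (hF : InitialEnlargement.UsualConditions F P)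
    (L : Ω → ℝ) (hL : Measurable L)
    (Q : ∀ t : InitialEnlargement.Time T, @Kernel Ω ℝ (F t) inferInstance)
    (hQ : ∀ t, InitialEnlargement.IsRegularCondLaw P L (F t) (Q t))
    (hA : InitialEnlargement.ConditionA P F Q)
    (q : ℝ → InitialEnlargement.Time T → Ω → ℝ)
    (hq : InitialEnlargement.IsConditionalDensity P F L Q q)
    (M : InitialEnlargement.Time T → Ω → ℝ)
    (hM : InitialEnlargement.IsLocalMartingale F P M)
    (hMcont : ∀ᵐ ω ∂P, Continuous (fun t => M t ω))
    (C : InitialEnlargement.Time T → Ω → ℝ)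
    (hC : InitialEnlargement.IsQuadraticVariation F P M C)
    (k : ℝ → InitialEnlargement.Time T → Ω → ℝ)
    (hk : InitialEnlargement.IsJointlyProgressive F k)
    (D : ℝ → InitialEnlargement.Time T → Ω → ℝ)
    (hD : ∀ x, InitialEnlargement.IsBracket F P (q x) M (D x))
    (hkD : ∀ x, ∀ᵐ ω ∂P,
      Integrable (fun s => k x s ω * Function.leftLim (fun u => q x u ω) s)
        (InitialEnlargement.pathMeasure (fun u => C u ω)) ∧
      ∀ t, D x t ω = ∫ s in Ioc ⊥ t, k x s ω * Function.leftLim (fun u => q x u ω) s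
        ∂(InitialEnlargement.pathMeasure (fun u => C u ω))) :
    (∀ᵐ ω ∂P, Integrable (fun s => k (L ω) s ω)
      (InitialEnlargement.pathMeasure (fun u => C u ω))) ∧
    StronglyAdapted (InitialEnlargement.enlargement F L hL)
      (InitialEnlargement.compensator k L C) ∧
    (∀ᵐ ω ∂P, Continuous (fun t => InitialEnlargement.compensator k L C t ω) ∧
      BoundedVariationOn (fun t => InitialEnlargement.compensator k L C t ω) univ) ∧
    InitialEnlargement.IsLocalMartingale (InitialEnlargement.enlargement F L hL) P
      (fun t ω => M t ω - InitialEnlargement.compensator k L C t ω) := by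
  classical
  -- `M` and `C` are set to zero off this almost sure event, so that path regularity holds
  -- everywhere; completeness keeps them adapted.
  let G : Set Ω := {ω | Continuous (fun t => M t ω) ∧ Continuous (fun t => C t ω) ∧
    Monotone (fun t => C t ω)}
  have hG : ∀ᵐ ω ∂P, ω ∈ G := by
    filter_upwards [hMcont, hC.continuous, hC.monotone] with ω h1 h2 h3 using ⟨h1, h2, h3⟩
  let M' : Time T → Ω → ℝ := fun t => G.indicator (M t)
  let C' : Time T → Ω → ℝ := fun t => G.indicator (C t)
  have hM'G : ∀ ω ∈ G, ∀ t, M' t ω = M t ω := fun ω hω t => indicator_of_mem hω _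
  have hM'c : ∀ ω, Continuous fun t => M' t ω := fun ω => by
    by_cases hω : ω ∈ G
    · simpa only [hM'G ω hω] using hω.1
    · simp only [M', indicator_of_notMem hω, continuous_const]
  have hC'c : ∀ ω, Continuous (fun t => C' t ω) ∧ Monotone (fun t => C' t ω) := fun ω => by
    by_cases hω : ω ∈ G
    · simpa only [C', indicator_of_mem hω] using hω.2
    · simp only [C', indicator_of_notMem hω]
      exact ⟨continuous_const, monotone_const⟩
  have hM' : StronglyAdapted F M' := fun t => (hM.adapted t).indicator (hF.measurableSet hG t)
  have hC' : StronglyAdapted F C' := fun t =>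
    (hC.predictable.stronglyAdapted t).indicator (hF.measurableSet hG t)
  let κ : Ω → Measure (Time T) := fun ω => pathMeasure fun u => C' u ω
  have hκf : ∀ ω, IsFiniteMeasure (κ ω) := fun ω =>
    isFiniteMeasure_pathMeasure (hC'c ω).1 (hC'c ω).2
  have hκ0 : ∀ ω t, κ ω {t} = 0 := fun ω t => pathMeasure_singleton (hC'c ω).1 (hC'c ω).2 t
  have hκ : IsAdaptedMeasure F κ := fun t => by
    simp only [κ, pathMeasure_Iic (hC'c _).1 (hC'c _).2]
    exact ((hC' t).measurable.sub ((hC' ⊥).measurable.mono (F.mono bot_le) le_rfl)).ennreal_ofReal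
  have hκG : ∀ ω ∈ G, pathMeasure (fun u => C u ω) = κ ω := fun ω hω => by
    simp only [κ, C', indicator_of_mem hω]
  -- The local martingale is `q^x M - ⟨q^x, M⟩`, rewritten with `q` instead of its left limit and
  -- with `Iic t` instead of `Ioc ⊥ t`, as `κ` has no atoms.
  have hN : ∀ x, ∃ N, IsLocalMartingale F P N ∧ ∀ᵐ ω ∂P,
      Integrable (fun u => k x u ω * q x u ω) (κ ω) ∧
      ∀ t, N t ω = q x t ω * M' t ω - ∫ u in Iic t, k x u ω * q x u ω ∂κ ω := by
    intro x
    refine ⟨_, (hD x).isLocalMartingale, ?_⟩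
    filter_upwards [hkD x, hG] with ω hω hωG
    rw [hκG ω hωG] at hω
    have hl : (fun u => k x u ω * Function.leftLim (fun u => q x u ω) u) =ᵐ[κ ω]
        fun u => k x u ω * q x u ω := by
      filter_upwards [leftLim_ae_eq_of_isCadlag (hq.cadlag x ω) (hC'c ω).1 (hC'c ω).2] with u hu
      rw [hu]
    refine ⟨hω.1.congr hl, fun t => ?_⟩
    rw [hω.2 t, hM'G ω hωG, setIntegral_Ioc_bot_eq (hκ0 ω ⊥),
      integral_congr_ae (ae_restrict_of_ae hl)]
  have hfin := ae_lintegral_comp_lt_top hL (hQ ⊤) hq hκ hk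
    fun x => (hN x).choose_spec.2.mono fun ω h => h.1
  have hint : ∀ᵐ ω ∂P, Integrable (fun s => k (L ω) s ω) (κ ω) := by
    filter_upwards [hfin] with ω hω
    refine ⟨(Measurable.aestronglyMeasurable ?_), hω⟩
    exact hk.isProgressive.measurable.comp (measurable_prodMk_left (x := (L ω, ω)))
  let A : Time T → Ω → ℝ := fun t ω => ∫ u in Iic t, k (L ω) u ω ∂κ ω
  have hAm : ∀ t, Measurable[enlargement F L hL t] (A t) := fun t =>
    (((hk.isProgressive.setIntegral_Iic hκ.comp_snd).measurable_apply t).mono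
      ((parametrized F).le_rightCont t) le_rfl).comp (measurable_prodMk_enlargement F hL t)
  have hcomp : ∀ᵐ ω ∂P, ∀ t, A t ω = compensator k L C t ω := by
    filter_upwards [hG] with ω hω t
    rw [compensator, hκG ω hω, setIntegral_Ioc_bot_eq (hκ0 ω ⊥)]
  have hnull : ∀ t S, P S = 0 → MeasurableSet[enlargement F L hL t] S := fun t S hS =>
    hF.measurableSet_enlargement hL t hS
  have hadapted : StronglyAdapted (enlargement F L hL) (compensator k L C) := fun t =>
    (measurable_of_ae_eq_of_complete (hnull t) (hAm t)
      (hcomp.mono fun ω h => h t)).stronglyMeasurable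
  have hcont : ∀ᵐ ω ∂P, Continuous (fun t => compensator k L C t ω) := by
    filter_upwards [hcomp, hint] with ω h1 h2
    simp only [← h1]
    exact continuous_setIntegral_Iic (hκ0 ω) h2
  refine ⟨?_, hadapted, ?_, fun t => ?_, ?_, ?_⟩
  · filter_upwards [hG, hint] with ω h1 h2
    rwa [hκG ω h1]
  · filter_upwards [hcont, hcomp, hint] with ω h0 h1 h2
    refine ⟨h0, ?_⟩
    simp only [← h1]
    exact boundedVariationOn_setIntegral_Iic h2
  · exact ((hM.adapted t).mono (le_enlargement F hL t)).sub (hadapted t)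
  · filter_upwards [hMcont, hcont] with ω h1 h2 using isCadlag_of_continuous (h1.sub h2)
  · refine ⟨exitTime κ M' fun p => k (L p.1) p.2 p.1, ⟨⟨fun n => ?_, ?_⟩, ?_⟩, fun n => ?_⟩
    · exact isStoppingTime_exitTime_enlargement hL hκ hM' hM'c hk n
    · filter_upwards [hfin] with ω hω
      exact tendsto_const_nhds.congr'
        ((eventually_exitTime_eq_top hM'c hω).mono fun n h => h.symm)
    · exact ae_of_all _ monotone_exitTime
    -- The martingale built from the modified paths is a version of the required stopped process,
    -- and `G_t` contains all null sets.
    · refine martingale_of_ae_eq hnull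
        (martingale_stoppedFamily hF hL (hQ ⊤) hq hκ0 hκ hM' hM'c hk hN n) fun t => ?_
      filter_upwards [hG, hcomp] with ω h1 h2
      have h3 : ∀ u, M' u ω - A u ω = M u ω - compensator k L C u ω := fun u => by
        rw [hM'G ω h1, h2]
      set τ : Ω → WithTop (Time T) := exitTime κ M' (fun p => k (L p.1) p.2 p.1) n
      change stoppedCompensated κ M' (fun p => k (L p.1) p.2 p.1) τ t ω = _
      rw [stoppedCompensated, stoppedProcess]
      by_cases hpos : ⊥ < τ ω
      · rw [indicator_of_mem (show ω ∈ {ω | ⊥ < τ ω} from hpos),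
          indicator_of_mem (show ω ∈ {ω | ⊥ < τ ω} from hpos)]
        exact h3 _
      · rw [indicator_of_notMem (show ω ∉ {ω | ⊥ < τ ω} from hpos),
          indicator_of_notMem (show ω ∉ {ω | ⊥ < τ ω} from hpos)]
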